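/- Let $\nabla_{mn}=\nabla(m-n)$ $(m,n\in\mathbb Z)$ be a nonzero lattice difference operator with complex entries: $|\nabla(k)|\le L e^{-M|k|}$ for some $L,M>0$, and $\sum_k\nabla(k)=0$. Consider commuting variables $\phi_{\pm n},F_{\pm n}$ and anticommuting variables $\chi_{\pm n},\bar\chi_{\pm n}$ $(n\in\mathbb Z)$, together with site-independent commuting constants $\rho^i_\pm$ and anticommuting constants $\zeta^i_\pm$ $(1\le i\le N_{CF})$. The fermion number $N_F$ is $0$ for $\phi,F,\rho$; $1$ for $\chi$; $-1$ for $\bar\chi,\zeta$. A local functional is a formal sum of monomials in these variables over all sites, whose coefficients are translationally invariant and, for each kind of monomial, decay exponentially in every difference of two of its sites (such coefficients are called TILCs). With left derivatives and $A\cdot B=\sum_n A_nB_n$, put $$Q'_+=\bar\chi_+\cdot\tfrac{\partial}{\partial\phi_+}+F_+\cdot\tfrac{\partial}{\partial\chi_+}-i\nabla\phi_-\cdot\tfrac{\partial}{\partial\chi_-}-i\nabla\bar\chi_-\cdot\tfrac{\partial}{\partial F_-}+\sum_i\zeta^i_+\tfrac{\partial}{\partial\rho^i_+},$$ $$Q'_-=i\nabla\phi_+\cdot\tfrac{\partial}{\partial\chi_+}-i\nabla\bar\chi_+\cdot\tfrac{\partial}{\partial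 F_+}-\bar\chi_-\cdot\tfrac{\partial}{\partial\phi_-}+F_-\cdot\tfrac{\partial}{\partial\chi_-}-\sum_i\zeta^i_-\tfrac{\partial}{\partial\rho^i_-},$$ and let $N'_\pm$ be the operator that counts the variables of type $\pm$ (constants included). A functional $\mathcal O$ is of $\pm$type if $N'_\mp\mathcal O=0$ and all eigenvalues of $N'_\pm$ on $\mathcal O$ are nonzero (the zero functional is included). Theorem. Let $\mathcal P'_\pm$ be a $\pm$type local functional with $N_F=1$ and $Q'_\mp\mathcal P'_\pm=0$. Then $$\mathcal P'_\pm=\sum_{k\ge0}\ \sum_{m,n_1,\dots,n_k}C'_{mn_1\cdots n_k}(\rho_\pm)\,\chi_{\pm m}\phi_{\pm n_1}\cdots\phi_{\pm n_k}+Q'_\mp\mathcal Q'_\pm ,$$ where $\mathcal Q'_\pm$ is a $\pm$type local functional with $N_F=2$, which may depend on $\rho^i_\pm,\zeta^i_\pm$, and the $C'_{mn_1\cdots n_k}(\rho_\pm)$ are formal power series in the $\rho^i_\pm$ whose coefficients are TILCs, are symmetric in $n_1,\dots,n_k$, and satisfy the cyclic Leibniz rule (CLR) $$\sum_{p\ \mathrm{cyclic\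 permutation\ of}\ \{0,\dots,k\}}\ \sum_m\nabla_{mn_{p(0)}}C'_{mn_{p(1)}\cdots n_{p(k)}}(\rho_\pm)=0 .$$ Both terms can be chosen degree by degree: if $\mathcal P'_\pm$ has no monomials of total degree $d$ (constants counted), then neither have the CLR sum and $\mathcal Q'_\pm$. In particular, if $\mathcal P'_\pm$ is a polynomial functional, then so are $\mathcal Q'_\pm$ and the CLR sum. -/

import Mathlib

namespace LatticeSUSY

/-- The two types of fields, `+` and `-`. -/
inductive Chirality
  | plus
  | minus
  deriving DecidableEq

/-- The opposite type: the index `∓` that goes with `±`. -/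
def Chirality.flip : Chirality → Chirality
  | .plus => .minus
  | .minus => .plus

/-- The variables from which functionals are built: at each lattice site `n : ℤ` the fields
`φ_{±n}`, `χ_{±n}`, `χ̄_{±n}`, `F_{±n}`, and the site-independent constant fields `ρ^i_±` with
their superpartners `ζ^i_±`, where `i` runs through `Fin N`. -/
inductive Letter (N : ℕ)
  | phi (s : Chirality) (n : ℤ)
  | chi (s : Chirality) (n : ℤ)
  | chibar (s : Chirality) (n : ℤ)
  | F (s : Chirality) (n : ℤ)
  | rho (s : Chirality) (i : Fin N)
  | zeta (s : Chirality) (i : Fin N)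
  deriving DecidableEq

namespace Letter

variable {N : ℕ}

/-- The type (`+` or `-`) of a variable. -/
def chirality : Letter N → Chirality
  | phi s _ => s
  | chi s _ => s
  | chibar s _ => s
  | F s _ => s
  | rho s _ => s
  | zeta s _ => s

/-- The fermion number `N_F` of a variable. -/
def fermionNumber : Letter N → ℤ
  | phi _ _ => 0
  | chi _ _ => 1
  | chibar _ _ => -1
  | F _ _ => 0
  | rho _ _ => 0
  | zeta _ _ => -1

/-- Grassmann parity: `true` for the anticommuting variables `χ`, `χ̄`, `ζ`. -/
def isOdd : Letter N → Bool
  | phi _ _ => false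
  | chi _ _ => true
  | chibar _ _ => true
  | F _ _ => false
  | rho _ _ => false
  | zeta _ _ => true

/-- The lattice site of a variable; the constant fields have none. -/
def site : Letter N → Option ℤ
  | phi _ n => some n
  | chi _ n => some n
  | chibar _ n => some n
  | F _ n => some n
  | rho _ _ => none
  | zeta _ _ => none

/-- Lattice translation by `a`; the constant fields are not affected. -/
def shift (a : ℤ) : Letter N → Letter N
  | phi s n => phi s (n + a)
  | chi s n => chi s (n + a)
  | chibar s n => chibar s (n + a)
  | F s n => F s (n + a)
  | rho s i => rho s i
  | zeta s i => zeta s i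

/-- The sign in `x y = ± y x`. -/
def swapSign (x y : Letter N) : ℂ := if x.isOdd && y.isOdd then -1 else 1

end Letter

/-- A word `x₁ x₂ ⋯ x_r` of variables, standing for their product in this order. -/
abbrev Word (N : ℕ) := List (Letter N)

/-- A family of complex coefficients `f`, standing for the formal sum `∑_w f(w) w` over all
words, that is, over all monomials and all sites. -/
abbrev Coeffs (N : ℕ) := Word N → ℂ

/-- The sign `ε` in `w_{σ(0)} w_{σ(1)} ⋯ = ε · w_0 w_1 ⋯`. -/
noncomputable def koszulSign {N : ℕ} (w : Word N) (σ : Equiv.Perm (Fin w.length)) : ℂ :=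
  ∏ i : Fin w.length, ∏ j : Fin w.length,
    if i < j ∧ σ j < σ i then Letter.swapSign (w.get (σ i)) (w.get (σ j)) else 1

/-- Collecting terms: `∑_w a(w) w` rewritten with coefficients that are symmetric in the bosonic
and antisymmetric in the fermionic variables. -/
noncomputable def superSymmetrize {N : ℕ} (a : Coeffs N) : Coeffs N := fun w =>
  ((w.length.factorial : ℂ))⁻¹ *
    ∑ σ : Equiv.Perm (Fin w.length),
      koszulSign w σ * a (List.ofFn fun i => w.get (σ i))

/-- Supersymmetric coefficients: exchanging two adjacent variables gives the sign of their
(anti)commutation relation.  Every formal sum of monomials has exactly one such family of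
coefficients, so that two functionals are equal iff these families are. -/
def IsSuperSymmetric {N : ℕ} (f : Coeffs N) : Prop :=
  ∀ (u v : Word N) (x y : Letter N),
    f (u ++ x :: y :: v) = Letter.swapSign x y * f (u ++ y :: x :: v)

/-- The lattice sites that occur in a word. -/
def sites {N : ℕ} (w : Word N) : List ℤ := w.filterMap Letter.site

/-- Translational invariance of the coefficients. -/
def IsTranslationInvariant {N : ℕ} (f : Coeffs N) : Prop :=
  ∀ (a : ℤ) (w : Word N), f (w.map (Letter.shift a)) = f w

/-- Locality of the coefficients: in each degree they decay exponentially in every difference of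
two sites.  There are finitely many kinds of monomials of a given degree. -/
def IsLocal {N : ℕ} (f : Coeffs N) : Prop :=
  ∀ d : ℕ, ∃ L M : ℝ, 0 < L ∧ 0 < M ∧
    ∀ w : Word N, w.length = d → ∀ m ∈ sites w, ∀ n ∈ sites w,
      ‖f w‖ ≤ L * Real.exp (-M * |((m - n : ℤ) : ℝ)|)

/-- A local functional: a formal sum of monomials of the fields and of the constant fields, with
translationally invariant local coefficients. -/
structure IsLocalFunctional {N : ℕ} (f : Coeffs N) : Prop where
  superSymmetric : IsSuperSymmetric f
  translationInvariant : IsTranslationInvariant f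
  isLocal : IsLocal f

/-- `f` is of fermion number `q`: every monomial that occurs in it is. -/
def HasFermionNumber {N : ℕ} (q : ℤ) (f : Coeffs N) : Prop :=
  ∀ w : Word N, f w ≠ 0 → (w.map Letter.fermionNumber).sum = q

/-- `f` has no terms of total degree `d`. -/
def VanishesInDegree {N : ℕ} (d : ℕ) (f : Coeffs N) : Prop :=
  ∀ w : Word N, w.length = d → f w = 0

/-- The derivation `∑_y (A y) · ∂/∂y`, where `A y = ∑_x q(y, x) x`, with left derivatives:
`x₁ ⋯ x_r ↦ ∑_i ± x₁ ⋯ (A x_i) ⋯ x_r`, where for an odd derivation the sign is `-1` to the number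
of odd variables among `x₁, …, x_{i-1}`.  This is its action on the coefficients. -/
noncomputable def derivation {N : ℕ} (odd : Bool) (q : Letter N → Letter N → ℂ)
    (f : Coeffs N) : Coeffs N := fun w =>
  ∑ i : Fin w.length,
    (if odd then (-1 : ℂ) ^ ((w.take i).countP Letter.isOdd) else 1) *
      ∑' y : Letter N, q y (w.get i) * f (w.set i y)

/-- The coefficient of `x` in `Q'_± y`, where the lattice difference operator is
`(∇ φ)_m = ∑_n D(m - n) φ_n`. -/
noncomputable def superchargeMatrix {N : ℕ} (D : ℤ → ℂ) :
    Chirality → Letter N → Letter N → ℂ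
  | .plus, .phi .plus m, .chibar .plus n => if m = n then 1 else 0
  | .plus, .chi .plus m, .F .plus n => if m = n then 1 else 0
  | .plus, .chi .minus m, .phi .minus n => -Complex.I * D (m - n)
  | .plus, .F .minus m, .chibar .minus n => -Complex.I * D (m - n)
  | .plus, .rho .plus i, .zeta .plus j => if i = j then 1 else 0
  | .minus, .chi .plus m, .phi .plus n => Complex.I * D (m - n)
  | .minus, .F .plus m, .chibar .plus n => -Complex.I * D (m - n)
  | .minus, .phi .minus m, .chibar .minus n => if m = n then -1 else 0
  | .minus, .chi .minus m, .F .minus n => if m = n then 1 else 0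
  | .minus, .rho .minus i, .zeta .minus j => if i = j then -1 else 0
  | _, _, _ => 0

/-- The extended supercharge `Q'_±`. -/
noncomputable def supercharge {N : ℕ} (D : ℤ → ℂ) (s : Chirality) : Coeffs N → Coeffs N :=
  derivation true (superchargeMatrix D s)

/-- The extended number operator `N'_± = ∑ y ∂/∂y`, the sum being over all variables of type `±`,
constant fields included. -/
noncomputable def numberOp {N : ℕ} (s : Chirality) : Coeffs N → Coeffs N :=
  derivation false fun y x => if y = x ∧ y.chirality = s then 1 else 0

/-- `±`type functionals: `N'_∓ f = 0`, and `N'_±` annihilates no monomial of `f`, that is, all its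
eigenvalues on `f` are nonzero. -/
def IsOfType {N : ℕ} (s : Chirality) (f : Coeffs N) : Prop :=
  numberOp s.flip f = 0 ∧ ∀ w : Word N, f w ≠ 0 → numberOp s f w ≠ 0

/-- A local lattice difference operator `∇_{mn} = D(m - n)`: exponentially decaying, zero on
constants, and not the zero operator. -/
structure IsDifferenceOperator (D : ℤ → ℂ) : Prop where
  isLocal : ∃ L M : ℝ, 0 < L ∧ 0 < M ∧ ∀ k : ℤ, ‖D k‖ ≤ L * Real.exp (-M * |(k : ℝ)|)
  sum_eq_zero : ∑' k : ℤ, D k = 0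
  ne_zero : D ≠ 0

/-- Coefficients `C'_{m n₁ ⋯ n_k}(ρ) = ∑ C'_{i₁ ⋯ i_r; m n₁ ⋯ n_k} ρ^{i₁} ⋯ ρ^{i_r}`; the value at
`[i₁, …, i_r]`, `m`, `[n₁, …, n_k]`. -/
abbrev CLRCoeffs (N : ℕ) := List (Fin N) → ℤ → List ℤ → ℂ

/-- `C'` is symmetric, is a translationally invariant local coefficient, and satisfies the cyclic
Leibniz rule. -/
structure SatisfiesCLR {N : ℕ} (D : ℤ → ℂ) (C : CLRCoeffs N) : Prop where
  symm_const : ∀ (is js : List (Fin N)) (m : ℤ) (ns : List ℤ), is.Perm js → C is m ns = C js m ns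
  symm_sites : ∀ (is : List (Fin N)) (m : ℤ) (ns ls : List ℤ), ns.Perm ls → C is m ns = C is m ls
  translationInvariant : ∀ (is : List (Fin N)) (m : ℤ) (ns : List ℤ) (a : ℤ),
    C is (m + a) (ns.map (· + a)) = C is m ns
  isLocal : ∀ r k : ℕ, ∃ L M : ℝ, 0 < L ∧ 0 < M ∧
    ∀ (is : List (Fin N)) (m : ℤ) (ns : List ℤ), is.length = r → ns.length = k →
      ∀ n ∈ ns, ‖C is m ns‖ ≤ L * Real.exp (-M * |((m - n : ℤ) : ℝ)|)
  /-- The sum is over the cyclic permutations `j ↦ p + j` of `{0, 1, …, k}`. -/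
  cyclicLeibniz : ∀ (is : List (Fin N)) (k : ℕ) (n : Fin (k + 1) → ℤ),
    ∑ p : Fin (k + 1), ∑' m : ℤ,
      D (m - n p) * C is m (List.ofFn fun j : Fin k => n (p + j.succ)) = 0

/-- The word `ρ^{i₁}_± ⋯ ρ^{i_r}_± χ_{±m} φ_{±n₁} ⋯ φ_{±n_k}`. -/
def clrWord {N : ℕ} (s : Chirality) (t : List (Fin N) × ℤ × List ℤ) : Word N :=
  t.1.map (Letter.rho s) ++ Letter.chi s t.2.1 :: t.2.2.map (Letter.phi s)

/-- The functional `∑_k ∑_{m n₁ ⋯ n_k} C'_{m n₁ ⋯ n_k}(ρ_±) χ_{±m} φ_{±n₁} ⋯ φ_{±n_k}`. -/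
noncomputable def clrTerm {N : ℕ} (s : Chirality) (C : CLRCoeffs N) : Coeffs N :=
  superSymmetrize (Function.extend (clrWord s) (fun t => C t.1 t.2.1 t.2.2) 0)

end LatticeSUSY

open LatticeSUSY

/-!
# Closed functionals of fermion number one and the cyclic Leibniz rule

On functionals of the variables of type `s` the supercharge of the opposite type sends `χ_s` to a
multiple of `∇ φ_s` and `F_s` to a multiple of `∇ χ̄_s`, and kills `φ_s`, `χ̄_s`, `ρ_s`, `ζ_s`. So
it is a Koszul differential: the variables `χ_s`, `F_s` are called high, `φ_s`, `χ̄_s` low, and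
the differential lowers the number of high factors of a monomial by one. A closed functional
splits into closed parts according to that number. The theorem follows from two facts.

* A monomial with fermion number `1` and at most one high factor has the form `ρ ⋯ ρ χ φ ⋯ φ`
  (`exists_perm_clrWord`), and the closedness of such a part says that its coefficients satisfy
  the cyclic Leibniz rule (`cyclicLeibniz_of_closed`).  A monomial may occur several times in the
  sum over all sites, whence the combinatorial factor in `satisfiesCLR_of_closed` and
  `clrTerm_apply`.
* A closed local functional all of whose monomials have at least two high factors is exact, with a
  local primitive (`exists_symmetric_primitive`).

For the second fact, `∇` has to be divided out without losing locality. The symbol of `∇` may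
vanish on the unit circle, so `∇` has no decaying translation invariant inverse. But its zeros are
isolated, and expanding the inverse of the symbol on a circle slightly outside or slightly inside
the unit circle, depending on the sign of the output site, gives a kernel that is a left inverse
of the transpose of `∇` on exponentially decaying sequences and maps them to exponentially
decaying ones (`exists_left_inverse_kernel`). It singles out an origin. Translation invariance is
kept by taking the site of one factor of the monomial, the reference factor, as the origin. The
coefficients of a local functional decay in the distances of the other factors from it, so
division by `∇` can be applied to the other factors one at a time, and the differential of the
other factors is exact on monomials with a high factor among them (`exists_primitive_erase`). The
differential of the reference factor turns a high reference factor into a low one; solving first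
on monomials with a high reference factor and then on the rest takes care of it
(`exists_primitive_univ`), which needs a second high factor and is the reason why the part with a
single one survives. Finally the primitives for all reference factors are averaged and
(anti)symmetrized.

For every degree `d`, coefficients are treated as functions on `Fin d → Letter N`; on them the
operators act in the transposed direction, from low to high variables.
-/

namespace LatticeSUSY

/-! ### Division by a lattice difference operator -/

theorem summable_exp_neg_mul_abs {c : ℝ} (hc : 0 < c) :
    Summable fun k : ℤ => Real.exp (-c * |(k : ℝ)|) := by
  have h : Summable fun n : ℕ => Real.exp (-c * |((n : ℤ) : ℝ)|) := by
    have := Real.summable_exp_nat_mul_iff.mpr (neg_lt_zero.mpr hc)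
    refine this.congr fun n => ?_
    simp [mul_comm]
  refine Summable.of_nat_of_neg h ?_
  refine h.congr fun n => ?_
  simp

/-- The symbol `w ↦ ∑_k D(k) e^{-kw}` of a lattice operator, a Laurent series in `e^{-w}`. -/
noncomputable def symbol (D : ℤ → ℂ) (w : ℂ) : ℂ := ∑' k : ℤ, D k * Complex.exp (-(k : ℂ) * w)

theorem norm_symbol_term_le {D : ℤ → ℂ} {L M c : ℝ} (hL : 0 < L)
    (hD : ∀ k : ℤ, ‖D k‖ ≤ L * Real.exp (-M * |(k : ℝ)|)) (k : ℤ) {w : ℂ} (hw : |w.re| ≤ c) :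
    ‖D k * Complex.exp (-(k : ℂ) * w)‖ ≤ L * Real.exp (-(M - c) * |(k : ℝ)|) := by
  have hre : (-(k : ℂ) * w).re = -(k : ℝ) * w.re := by
    simp
  rw [norm_mul, Complex.norm_exp, hre]
  have h1 : -(k : ℝ) * w.re ≤ c * |(k : ℝ)| := by
    calc -(k : ℝ) * w.re ≤ |-(k : ℝ) * w.re| := le_abs_self _
      _ = |(k : ℝ)| * |w.re| := by rw [abs_mul, abs_neg]
      _ ≤ |(k : ℝ)| * c := by gcongr
      _ = _ := mul_comm _ _
  calc ‖D k‖ * Real.exp (-(k : ℝ) * w.re)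
      ≤ (L * Real.exp (-M * |(k : ℝ)|)) * Real.exp (c * |(k : ℝ)|) := by
        gcongr
        exact hD k
    _ = L * Real.exp (-(M - c) * |(k : ℝ)|) := by
        rw [mul_assoc, ← Real.exp_add]; ring_nf

theorem integral_exp_int_mul (j : ℤ) (τ : ℝ) :
    ∫ θ in (0 : ℝ)..(2 * Real.pi), Complex.exp ((j : ℂ) * (τ + θ * Complex.I)) =
      if j = 0 then (2 * Real.pi : ℂ) else 0 := by
  split_ifs with h
  · simp [h]
  · have hc : (j : ℂ) * Complex.I ≠ 0 := mul_ne_zero (Int.cast_ne_zero.mpr h) Complex.I_ne_zero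
    have : ∀ θ : ℝ, Complex.exp ((j : ℂ) * (τ + θ * Complex.I)) =
        Complex.exp ((j : ℂ) * τ) * Complex.exp ((j : ℂ) * Complex.I * θ) := by
      intro θ
      rw [← Complex.exp_add]; ring_nf
    simp_rw [this]
    rw [intervalIntegral.integral_const_mul, integral_exp_mul_complex hc]
    have h2 : Complex.exp ((j : ℂ) * Complex.I * ((2 * Real.pi : ℝ) : ℂ)) = 1 := by
      rw [Complex.exp_eq_one_iff]
      exact ⟨j, by push_cast; ring⟩
    rw [h2]
    simp

theorem symbol_differentiableOn {D : ℤ → ℂ} {L M c : ℝ} (hL : 0 < L) (hc : c < M)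
    (hD : ∀ k : ℤ, ‖D k‖ ≤ L * Real.exp (-M * |(k : ℝ)|)) :
    DifferentiableOn ℂ (symbol D) {w : ℂ | |w.re| < c} := by
  refine Complex.differentiableOn_tsum_of_summable_norm
    ((summable_exp_neg_mul_abs (sub_pos.mpr hc)).mul_left L) (fun k => ?_) ?_ ?_
  · fun_prop
  · exact isOpen_lt (by fun_prop) (by fun_prop)
  · intro k w hw
    exact norm_symbol_term_le hL hD k (le_of_lt hw)

/-- Integrating a term by term sum over a circle `|e^w| = e^τ`. -/
theorem hasSum_integral_circle {D : ℤ → ℂ} {L M c : ℝ} (hL : 0 < L) (hc : c < M)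
    (hD : ∀ k : ℤ, ‖D k‖ ≤ L * Real.exp (-M * |(k : ℝ)|)) {τ : ℝ} (hτ : |τ| ≤ c)
    {u : ℝ → ℂ} (hu : Continuous u) :
    HasSum (fun k : ℤ => ∫ θ in (0 : ℝ)..(2 * Real.pi),
        D k * Complex.exp (-(k : ℂ) * (τ + θ * Complex.I)) * u θ)
      (∫ θ in (0 : ℝ)..(2 * Real.pi), symbol D (τ + θ * Complex.I) * u θ) := by
  obtain ⟨B, hB⟩ := (isCompact_Icc (a := (0 : ℝ)) (b := 2 * Real.pi)).exists_bound_of_continuousOn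
    hu.continuousOn
  have hre : ∀ θ : ℝ, |((τ : ℂ) + θ * Complex.I).re| ≤ c := by intro θ; simpa using hτ
  have hsum := summable_exp_neg_mul_abs (sub_pos.mpr hc)
  refine intervalIntegral.hasSum_integral_of_dominated_convergence
    (fun k _ => L * Real.exp (-(M - c) * |(k : ℝ)|) * B) (fun k => ?_) (fun k => ?_) ?_ ?_ ?_
  · apply Continuous.aestronglyMeasurable; fun_prop
  · refine Filter.Eventually.of_forall fun θ hθ => ?_
    rw [Set.uIoc_of_le (by positivity)] at hθ
    rw [norm_mul]
    exact mul_le_mul (norm_symbol_term_le hL hD k (hre θ)) (hB θ ⟨hθ.1.le, hθ.2⟩)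
      (norm_nonneg _) (by positivity)
  · exact Filter.Eventually.of_forall fun θ _ => (hsum.mul_left L).mul_right B
  · exact intervalIntegrable_const
  · refine Filter.Eventually.of_forall fun θ _ => ?_
    refine HasSum.mul_right _ (Summable.hasSum ?_)
    exact Summable.of_norm_bounded (hsum.mul_left L)
      fun k => norm_symbol_term_le hL hD k (hre θ)

/-- The coefficients of a Laurent series are determined by its sum on the unit circle. -/
theorem exists_symbol_ne_zero {D : ℤ → ℂ} {L M : ℝ} (hL : 0 < L) (hM : 0 < M)
    (hD : ∀ k : ℤ, ‖D k‖ ≤ L * Real.exp (-M * |(k : ℝ)|)) (h0 : D ≠ 0) :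
    ∃ θ : ℝ, symbol D (θ * Complex.I) ≠ 0 := by
  by_contra! hz
  apply h0
  funext n
  have key := hasSum_integral_circle hL hM hD (τ := 0) (by simp)
    (u := fun θ : ℝ => Complex.exp ((n : ℂ) * (θ * Complex.I))) (by fun_prop)
  have hterm : ∀ k : ℤ, ∫ θ in (0 : ℝ)..(2 * Real.pi),
      D k * Complex.exp (-(k : ℂ) * ((0 : ℝ) + θ * Complex.I)) *
        Complex.exp ((n : ℂ) * (θ * Complex.I)) =
      D k * if n - k = 0 then (2 * Real.pi : ℂ) else 0 := by
    intro k
    rw [← integral_exp_int_mul (n - k) 0, ← intervalIntegral.integral_const_mul]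
    congr 1; funext θ
    rw [mul_assoc, ← Complex.exp_add]
    push_cast
    ring_nf
  simp_rw [hterm] at key
  simp only [Complex.ofReal_zero, zero_add, hz, zero_mul, intervalIntegral.integral_zero] at key
  have h2 := hasSum_single (f := fun k : ℤ => D k * if n - k = 0 then (2 * Real.pi : ℂ) else 0) n
    (fun k hk => by rw [if_neg (sub_ne_zero.mpr hk.symm), mul_zero])
  have h3 := h2.unique key
  simpa [Real.pi_ne_zero] using h3

/-- The symbol has isolated zeros, so arbitrarily close to the unit circle there is a pair of
circles of reciprocal radii on which it does not vanish. -/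
theorem exists_zero_free_circles {D : ℤ → ℂ} {L M c : ℝ} (hL : 0 < L) (hM : 0 < M)
    (hD : ∀ k : ℤ, ‖D k‖ ≤ L * Real.exp (-M * |(k : ℝ)|)) (h0 : D ≠ 0) (hc : 0 < c) (hcM : c < M) :
    ∃ t, 0 < t ∧ t < c ∧ ∀ τ : ℝ, |τ| = t → ∀ θ ∈ Set.Icc (0 : ℝ) (2 * Real.pi),
      symbol D (τ + θ * Complex.I) ≠ 0 := by
  obtain ⟨c', hc', hcM'⟩ := exists_between hcM
  set U : Set ℂ := {w : ℂ | |w.re| < c'} with hU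
  have hUo : IsOpen U := isOpen_lt (by fun_prop) (by fun_prop)
  have hUc : Convex ℝ U := by
    have : U = Complex.reLm ⁻¹' (Set.Ioo (-c') c') := by
      ext w; simp [hU, abs_lt]
    rw [this]
    exact (convex_Ioo _ _).linear_preimage _
  have han : AnalyticOnNhd ℂ (symbol D) U :=
    (symbol_differentiableOn hL hcM' hD).analyticOnNhd hUo
  set K : Set ℂ := Set.Icc (-c) c ×ℂ Set.Icc 0 (2 * Real.pi) with hK
  have hKc : IsCompact K := isCompact_Icc.reProdIm isCompact_Icc
  have hKU : K ⊆ U := by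
    intro w hw
    exact (abs_le.mpr hw.1).trans_lt hc'
  have hfin : (K ∩ {w | symbol D w = 0}).Finite := by
    by_contra hinf
    obtain ⟨z, hzK, hz⟩ := Set.Infinite.exists_accPt_of_subset_isCompact hinf hKc
      Set.inter_subset_left
    have hfr : ∃ᶠ w in nhdsWithin z {z}ᶜ, symbol D w = 0 :=
      (accPt_iff_frequently_nhdsNE.mp hz).mono fun w hw => hw.2
    have hEq := han.eqOn_zero_of_preconnected_of_frequently_eq_zero hUc.isPreconnected
      (hKU hzK) hfr
    obtain ⟨θ, hθ⟩ := exists_symbol_ne_zero hL hM hD h0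
    exact hθ (hEq (by simpa [hU] using hc.trans hc'))
  have hfin2 := hfin.image fun w : ℂ => |w.re|
  obtain ⟨t, ht, htn⟩ := ((Set.Ioo_infinite hc).sdiff hfin2).nonempty
  refine ⟨t, ht.1, ht.2, fun τ hτ θ hθ hzero => htn ⟨τ + θ * Complex.I, ⟨?_, hzero⟩, ?_⟩⟩
  · have : |τ| ≤ c := hτ.trans_le ht.2.le
    refine ⟨?_, ?_⟩
    · simpa using abs_le.mp this
    · simpa using hθ
  · simpa using hτ

/-- A left inverse of a lattice operator on exponentially decaying sequences, given by a kernel `h`.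
The operator itself need not be invertible (its symbol may vanish on the unit circle), and `h` is
not translation invariant. -/
theorem exists_left_inverse_kernel {D : ℤ → ℂ} (hD : IsDifferenceOperator D) {c : ℝ} (hc : 0 < c) :
    ∃ t, 0 < t ∧ t < c ∧ ∃ K, 0 < K ∧ ∃ h : ℤ → ℤ → ℂ,
      (∀ n b, ‖h n b‖ ≤ K * (Real.exp (-t * |(n : ℝ)|) * Real.exp (t * |(b : ℝ)|))) ∧
      ∀ n m, HasSum (fun b => h n b * D (m - b)) (if m = n then 1 else 0) := by
  obtain ⟨L, M, hL, hM, hDb⟩ := hD.isLocal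
  have hc1 : 0 < min c (M / 2) := by positivity
  have hc2 : min c (M / 2) < M := (min_le_right _ _).trans_lt (by linarith)
  obtain ⟨t, ht0, htc, hne⟩ := exists_zero_free_circles hL hM hDb hD.ne_zero hc1 hc2
  have htM : t < M := htc.trans hc2
  -- The inverse of the symbol is expanded on the outer circle for `n ≥ 0` and on the inner one
  -- for `n < 0`; this choice makes the kernel decay in `n` in both directions.
  set τ : ℤ → ℝ := fun n => if 0 ≤ n then t else -t with hτ
  have hτabs : ∀ n, |τ n| = t := by
    intro n
    simp only [hτ]; split_ifs <;> simp [abs_of_pos ht0]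
  have hτn : ∀ n : ℤ, -(n : ℝ) * τ n = -t * |(n : ℝ)| := by
    intro n
    simp only [hτ]; split_ifs with h
    · rw [abs_of_nonneg (by exact_mod_cast h)]; ring
    · rw [abs_of_neg (by exact_mod_cast not_le.mp h)]; ring
  have hcont : ∀ n, ContinuousOn (fun θ : ℝ => (symbol D (τ n + θ * Complex.I))⁻¹)
      (Set.Icc 0 (2 * Real.pi)) := by
    intro n
    refine ContinuousOn.inv₀ ?_ (hne _ (hτabs n))
    obtain ⟨c', hc', hcM'⟩ := exists_between htM
    refine (symbol_differentiableOn hL hcM' hDb).continuousOn.comp (by fun_prop) ?_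
    intro θ _
    simpa [hτabs] using hc'
  have hbd : ∃ B, 0 < B ∧ ∀ n, ∀ θ ∈ Set.Icc (0 : ℝ) (2 * Real.pi),
      ‖(symbol D (τ n + θ * Complex.I))⁻¹‖ ≤ B := by
    obtain ⟨B1, hB1⟩ := isCompact_Icc.exists_bound_of_continuousOn (hcont 0)
    obtain ⟨B2, hB2⟩ := isCompact_Icc.exists_bound_of_continuousOn (hcont (-1))
    refine ⟨max 1 (max B1 B2), by positivity, fun n θ hθ => ?_⟩
    by_cases h : 0 ≤ n
    · have : τ n = τ 0 := by simp [hτ, h]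
      rw [this]
      exact (hB1 θ hθ).trans ((le_max_left _ _).trans (le_max_right _ _))
    · have : τ n = τ (-1) := by simp [hτ, h]
      rw [this]
      exact (hB2 θ hθ).trans ((le_max_right _ _).trans (le_max_right _ _))
  obtain ⟨B, hB0, hB⟩ := hbd
  -- A continuous extension of the inverse symbol off the fundamental interval.
  set g : ℤ → ℝ → ℂ := fun n =>
    Set.IccExtend (show (0 : ℝ) ≤ 2 * Real.pi by positivity)
      ((Set.Icc 0 (2 * Real.pi)).domRestrict fun θ : ℝ =>
        (symbol D (τ n + θ * Complex.I))⁻¹) with hg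
  have hgc : ∀ n, Continuous (g n) := fun n => (hcont n).domRestrict.Icc_extend'
  have hgv : ∀ n, ∀ θ ∈ Set.Icc (0 : ℝ) (2 * Real.pi),
      g n θ = (symbol D (τ n + θ * Complex.I))⁻¹ := by
    intro n θ hθ
    simp only [hg]
    rw [Set.IccExtend_of_mem _ _ hθ]; rfl
  have hpi : (0 : ℝ) ≤ 2 * Real.pi := by positivity
  refine ⟨t, ht0, htc.trans_le (min_le_left _ _), B, hB0, fun n b =>
    (2 * Real.pi : ℂ)⁻¹ * ∫ θ in (0 : ℝ)..(2 * Real.pi),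
      Complex.exp (((b - n : ℤ) : ℂ) * (τ n + θ * Complex.I)) * g n θ, ?_, ?_⟩
  · intro n b
    have h1 : ∀ θ ∈ Set.uIoc (0 : ℝ) (2 * Real.pi),
        ‖Complex.exp (((b - n : ℤ) : ℂ) * (τ n + θ * Complex.I)) * g n θ‖ ≤
          (Real.exp (-t * |(n : ℝ)|) * Real.exp (t * |(b : ℝ)|)) * B := by
      intro θ hθ
      rw [Set.uIoc_of_le hpi] at hθ
      have hθ' : θ ∈ Set.Icc (0 : ℝ) (2 * Real.pi) := ⟨hθ.1.le, hθ.2⟩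
      rw [norm_mul, hgv n θ hθ', Complex.norm_exp]
      have hre : ((((b - n : ℤ) : ℂ)) * (τ n + θ * Complex.I)).re =
          -t * |(n : ℝ)| + b * τ n := by
        rw [← hτn]; simp; ring
      rw [hre, Real.exp_add]
      have hb : (b : ℝ) * τ n ≤ t * |(b : ℝ)| := by
        calc (b : ℝ) * τ n ≤ |(b : ℝ) * τ n| := le_abs_self _
          _ = t * |(b : ℝ)| := by rw [abs_mul, hτabs, mul_comm]
      exact mul_le_mul (by gcongr) (hB n θ hθ') (norm_nonneg _) (by positivity)
    have h2 := intervalIntegral.norm_integral_le_of_norm_le_const h1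
    rw [norm_mul]
    calc _ ≤ ‖((2 * Real.pi : ℂ))⁻¹‖ *
          ((Real.exp (-t * |(n : ℝ)|) * Real.exp (t * |(b : ℝ)|)) * B * |2 * Real.pi - 0|) := by
          gcongr
      _ = _ := by
          have : ‖((2 * Real.pi : ℂ))⁻¹‖ = (2 * Real.pi)⁻¹ := by
            rw [norm_inv]; simp [abs_of_pos Real.pi_pos]
          rw [this, sub_zero, abs_of_nonneg hpi]
          field_simp
  · intro n m
    have key := hasSum_integral_circle hL htM hDb (hτabs n).le
      (u := fun θ : ℝ => Complex.exp (((m - n : ℤ) : ℂ) * (τ n + θ * Complex.I)) * g n θ)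
      ((by fun_prop : Continuous fun θ : ℝ =>
        Complex.exp (((m - n : ℤ) : ℂ) * (τ n + θ * Complex.I))).mul (hgc n))
    have hrhs : ∫ θ in (0 : ℝ)..(2 * Real.pi), symbol D (τ n + θ * Complex.I) *
        (Complex.exp (((m - n : ℤ) : ℂ) * (τ n + θ * Complex.I)) * g n θ) =
        if m - n = 0 then (2 * Real.pi : ℂ) else 0 := by
      rw [← integral_exp_int_mul (m - n) (τ n)]
      refine intervalIntegral.integral_congr fun θ hθ => ?_
      rw [Set.uIcc_of_le hpi] at hθ
      have := hne _ (hτabs n) θ hθ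
      simp only [hgv n θ hθ]
      field_simp
    rw [hrhs] at key
    have key2 := (key.mul_left ((2 * Real.pi : ℂ)⁻¹))
    have e1 : ((2 * Real.pi : ℂ)⁻¹) * (if m - n = 0 then (2 * Real.pi : ℂ) else 0) =
        if m = n then 1 else 0 := by
      simp only [sub_eq_zero]
      split_ifs
      · exact inv_mul_cancel₀ (by simp [Real.pi_ne_zero])
      · simp
    rw [e1] at key2
    rw [← (Equiv.subLeft m).hasSum_iff] at key2
    refine key2.congr_fun fun b => ?_
    simp only [Function.comp, Equiv.subLeft_apply]
    rw [mul_assoc, ← intervalIntegral.integral_mul_const]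
    congr 2; funext θ
    have : Complex.exp (((b - n : ℤ) : ℂ) * (τ n + θ * Complex.I)) =
        Complex.exp (-((m - b : ℤ) : ℂ) * (τ n + θ * Complex.I)) *
          Complex.exp (((m - n : ℤ) : ℂ) * (τ n + θ * Complex.I)) := by
      rw [← Complex.exp_add]
      push_cast
      ring_nf
    rw [this]
    ring

/-! ### Operators acting on one factor of a monomial -/

variable {N d : ℕ}

/-- The Grassmann parity of a variable as a sign. -/
noncomputable def Letter.parity (x : Letter N) : ℂ := if x.isOdd then -1 else 1

/-- The sign that an odd operator picks up on its way to the `i`-th factor. -/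
noncomputable def leftSign (v : Fin d → Letter N) (i : Fin d) : ℂ :=
  ∏ j ∈ Finset.Iio i, (v j).parity

theorem Letter.parity_mul_self (x : Letter N) : x.parity * x.parity = 1 := by
  unfold Letter.parity; split_ifs <;> norm_num

theorem norm_leftSign (v : Fin d → Letter N) (i : Fin d) : ‖leftSign v i‖ = 1 := by
  unfold leftSign
  rw [norm_prod]
  refine Finset.prod_eq_one fun j _ => ?_
  unfold Letter.parity; split_ifs <;> simp

theorem leftSign_mul_self (v : Fin d → Letter N) (i : Fin d) :
    leftSign v i * leftSign v i = 1 := by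
  unfold leftSign
  rw [← Finset.prod_mul_distrib]
  exact Finset.prod_eq_one fun j _ => Letter.parity_mul_self _

theorem leftSign_update_of_le (v : Fin d → Letter N) {i j : Fin d} (h : i ≤ j) (y : Letter N) :
    leftSign (Function.update v j y) i = leftSign v i := by
  unfold leftSign
  refine Finset.prod_congr rfl fun k hk => ?_
  rw [Function.update_of_ne]
  exact ((Finset.mem_Iio.mp hk).trans_le h).ne

theorem leftSign_update_of_lt (v : Fin d → Letter N) {i j : Fin d} (h : j < i) {y : Letter N}
    (hy : y.parity = -(v j).parity) :
    leftSign (Function.update v j y) i = -leftSign v i := by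
  unfold leftSign
  have hj : j ∈ Finset.Iio i := Finset.mem_Iio.mpr h
  rw [← Finset.mul_prod_erase _ _ hj, ← Finset.mul_prod_erase _ (fun k => (v k).parity) hj,
    Function.update_self, hy, neg_mul]
  congr 2
  refine Finset.prod_congr rfl fun k hk => ?_
  rw [Function.update_of_ne (Finset.ne_of_mem_erase hk)]

/-- The odd operator that replaces the `i`-th factor according to the kernel `K`; the kernel may
depend on the other factors. -/
noncomputable def opAt (i : Fin d) (K : (Fin d → Letter N) → Letter N → Letter N → ℂ)
    (f : (Fin d → Letter N) → ℂ) : (Fin d → Letter N) → ℂ := fun v =>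
  leftSign v i * ∑' y : Letter N, K v y (v i) * f (Function.update v i y)

/-- A kernel is odd if it changes the parity. -/
def IsOddKernel (k : Letter N → Letter N → ℂ) : Prop :=
  ∀ y x, k y x ≠ 0 → y.parity = -x.parity

theorem opAt_opAt {i j : Fin d} (hij : i ≠ j) {K K' : (Fin d → Letter N) → Letter N → Letter N → ℂ}
    {f : (Fin d → Letter N) → ℂ} {v : Fin d → Letter N}
    (hK : IsOddKernel (K v)) (hK'i : ∀ y, K' (Function.update v i y) = K' v) :
    opAt i K (opAt j K' f) v = (if i < j then -1 else 1) * (leftSign v i * leftSign v j) *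
      ∑' y, ∑' z, K v y (v i) * K' v z (v j) *
        f (Function.update (Function.update v i y) j z) := by
  unfold opAt
  simp only [hK'i, Function.update_of_ne hij.symm]
  rw [mul_comm (if i < j then (-1 : ℂ) else 1), mul_assoc, mul_assoc]
  congr 1
  rw [← tsum_mul_left, ← tsum_mul_left]
  refine tsum_congr fun y => ?_
  simp_rw [mul_assoc, tsum_mul_left]
  by_cases hy : K v y (v i) = 0
  · simp [hy]
  · split_ifs with h
    · rw [leftSign_update_of_lt v h (hK _ _ hy)]; ring
    · rw [leftSign_update_of_le v (not_lt.mp h)]; ring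

/-- Odd operators acting on different factors anticommute. -/
theorem opAt_anticomm {i j : Fin d} (hij : i ≠ j)
    {K K' : (Fin d → Letter N) → Letter N → Letter N → ℂ}
    {f : (Fin d → Letter N) → ℂ} {v : Fin d → Letter N}
    (hK : IsOddKernel (K v)) (hK' : IsOddKernel (K' v))
    (hKj : ∀ y, K (Function.update v j y) = K v) (hK'i : ∀ y, K' (Function.update v i y) = K' v)
    (hs : Summable fun p : Letter N × Letter N => K v p.1 (v i) * K' v p.2 (v j) *
      f (Function.update (Function.update v i p.1) j p.2)) :
    opAt i K (opAt j K' f) v = -opAt j K' (opAt i K f) v := by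
  rw [opAt_opAt hij hK hK'i, opAt_opAt hij.symm hK' hKj,
    ← Summable.tsum_comm (f := fun y z => K v y (v i) * K' v z (v j) *
      f (Function.update (Function.update v i y) j z)) hs]
  have e : ∀ y z, K' v y (v j) * K v z (v i) *
      f (Function.update (Function.update v j y) i z) = K v z (v i) * K' v y (v j) *
      f (Function.update (Function.update v i z) j y) := by
    intro y z
    rw [Function.update_comm hij, mul_comm (K' v y (v j))]
  simp_rw [e]
  rcases lt_or_gt_of_ne hij with h | h
  · rw [if_pos h, if_neg h.not_gt]; ring
  · rw [if_neg h.not_gt, if_pos h]; ring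

/-- The properties of the kernel of a differential of Koszul type that make it a differential on
bounded coefficients. -/
structure IsDifferentialKernel (q : Letter N → Letter N → ℂ) : Prop where
  odd : IsOddKernel q
  nilpotent : ∀ x y z, q y x ≠ 0 → q z y = 0
  summable : ∀ x, Summable fun y => ‖q y x‖
  bound : ∃ B, ∀ x, ∑' y, ‖q y x‖ ≤ B

/-- Bounded coefficients of monomials of degree `d`. -/
def IsBoundedCoeff (f : (Fin d → Letter N) → ℂ) : Prop := ∃ B, ∀ v, ‖f v‖ ≤ B

theorem IsBoundedCoeff.sub {f g : (Fin d → Letter N) → ℂ} (hf : IsBoundedCoeff f)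
    (hg : IsBoundedCoeff g) : IsBoundedCoeff (f - g) := by
  obtain ⟨A, hA⟩ := hf
  obtain ⟨B, hB⟩ := hg
  exact ⟨A + B, fun v => (norm_sub_le _ _).trans (add_le_add (hA v) (hB v))⟩

theorem IsBoundedCoeff.sum {ι : Type*} (T : Finset ι) {f : ι → (Fin d → Letter N) → ℂ}
    (hf : ∀ i ∈ T, IsBoundedCoeff (f i)) : IsBoundedCoeff (∑ i ∈ T, f i) := by
  classical
  induction T using Finset.induction_on with
  | empty => exact ⟨0, fun v => by simp⟩
  | insert a T ha ih =>
    obtain ⟨A, hA⟩ := hf a (Finset.mem_insert_self _ _)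
    obtain ⟨B, hB⟩ := ih fun i hi => hf i (Finset.mem_insert_of_mem hi)
    refine ⟨A + B, fun v => ?_⟩
    rw [Finset.sum_insert ha]
    exact (norm_add_le _ _).trans (add_le_add (hA v) (hB v))

namespace IsDifferentialKernel

variable {q : Letter N → Letter N → ℂ}

theorem summable_mul (hq : IsDifferentialKernel q) {f : (Fin d → Letter N) → ℂ}
    (hf : IsBoundedCoeff f) (v : Fin d → Letter N) (i : Fin d) (x : Letter N) :
    Summable fun y => q y x * f (Function.update v i y) := by
  obtain ⟨B, hB⟩ := hf
  refine Summable.of_norm_bounded ((hq.summable x).mul_right B) fun y => ?_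
  rw [norm_mul]
  gcongr
  exact hB _

theorem isBoundedCoeff_opAt (hq : IsDifferentialKernel q) {f : (Fin d → Letter N) → ℂ}
    (hf : IsBoundedCoeff f) (i : Fin d) : IsBoundedCoeff (opAt i (fun _ => q) f) := by
  obtain ⟨B, hB⟩ := hf
  obtain ⟨A, hA⟩ := hq.bound
  refine ⟨A * B, fun v => ?_⟩
  have hB0 : 0 ≤ B := (norm_nonneg _).trans (hB v)
  unfold opAt
  rw [norm_mul, norm_leftSign, one_mul]
  refine (tsum_of_norm_bounded ((hq.summable (v i)).hasSum.mul_right B) fun y => ?_).trans ?_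
  · rw [norm_mul]; gcongr; exact hB _
  · gcongr; exact hA _

theorem opAt_sub (hq : IsDifferentialKernel q) {f g : (Fin d → Letter N) → ℂ}
    (hf : IsBoundedCoeff f) (hg : IsBoundedCoeff g) (i : Fin d) :
    opAt i (fun _ => q) (f - g) = opAt i (fun _ => q) f - opAt i (fun _ => q) g := by
  funext v
  simp only [opAt, Pi.sub_apply, mul_sub]
  rw [(hq.summable_mul hf v i _).tsum_sub (hq.summable_mul hg v i _), mul_sub]

theorem opAt_sum (hq : IsDifferentialKernel q) {ι : Type*} (T : Finset ι)
    {f : ι → (Fin d → Letter N) → ℂ} (hf : ∀ i ∈ T, IsBoundedCoeff (f i)) (j : Fin d) :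
    opAt j (fun _ => q) (∑ i ∈ T, f i) = ∑ i ∈ T, opAt j (fun _ => q) (f i) := by
  funext v
  simp only [opAt, Finset.sum_apply, Finset.mul_sum]
  rw [Summable.tsum_finsetSum fun i hi => hq.summable_mul (hf i hi) v j _, Finset.mul_sum]

theorem opAt_anticomm (hq : IsDifferentialKernel q) {f : (Fin d → Letter N) → ℂ}
    (hf : IsBoundedCoeff f) {i j : Fin d} (hij : i ≠ j) :
    opAt i (fun _ => q) (opAt j (fun _ => q) f) =
      -opAt j (fun _ => q) (opAt i (fun _ => q) f) := by
  funext v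
  refine LatticeSUSY.opAt_anticomm hij hq.odd hq.odd (fun _ => rfl) (fun _ => rfl) ?_
  obtain ⟨B, hB⟩ := hf
  refine Summable.of_norm_bounded
    (((hq.summable (v i)).mul_of_nonneg (hq.summable (v j)) (fun _ => norm_nonneg _)
      fun _ => norm_nonneg _).mul_right B) fun p => ?_
  rw [norm_mul, norm_mul]
  gcongr
  exact hB _

theorem opAt_opAt_self (hq : IsDifferentialKernel q) (f : (Fin d → Letter N) → ℂ) (i : Fin d) :
    opAt i (fun _ => q) (opAt i (fun _ => q) f) = 0 := by
  funext v
  simp only [opAt, Function.update_self, Function.update_idem, Pi.zero_apply]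
  refine mul_eq_zero_of_right _ ?_
  rw [← tsum_zero (α := ℂ) (β := Letter N)]
  refine tsum_congr fun y => ?_
  by_cases hy : q y (v i) = 0
  · rw [hy, zero_mul]
  · simp [hq.nilpotent _ _ _ hy]

end IsDifferentialKernel

/-- The part of a Koszul differential that acts on the factors in `T`. -/
noncomputable def diffOn (q : Letter N → Letter N → ℂ) (T : Finset (Fin d))
    (f : (Fin d → Letter N) → ℂ) : (Fin d → Letter N) → ℂ :=
  ∑ i ∈ T, opAt i (fun _ => q) f

namespace IsDifferentialKernel

variable {q : Letter N → Letter N → ℂ}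

theorem diffOn_sub (hq : IsDifferentialKernel q) {f g : (Fin d → Letter N) → ℂ}
    (hf : IsBoundedCoeff f) (hg : IsBoundedCoeff g) (T : Finset (Fin d)) :
    diffOn q T (f - g) = diffOn q T f - diffOn q T g := by
  simp only [diffOn, hq.opAt_sub hf hg, Finset.sum_sub_distrib]

theorem diffOn_sum (hq : IsDifferentialKernel q) {ι : Type*} (S : Finset ι)
    {f : ι → (Fin d → Letter N) → ℂ} (hf : ∀ i ∈ S, IsBoundedCoeff (f i)) (T : Finset (Fin d)) :
    diffOn q T (∑ i ∈ S, f i) = ∑ i ∈ S, diffOn q T (f i) := by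
  simp only [diffOn, hq.opAt_sum S hf]
  rw [Finset.sum_comm]

theorem diffOn_diffOn (hq : IsDifferentialKernel q) {f : (Fin d → Letter N) → ℂ}
    (hf : IsBoundedCoeff f) (T : Finset (Fin d)) : diffOn q T (diffOn q T f) = 0 := by
  have h1 : diffOn q T (diffOn q T f) =
      ∑ i ∈ T, ∑ j ∈ T, opAt i (fun _ => q) (opAt j (fun _ => q) f) := by
    unfold diffOn
    exact Finset.sum_congr rfl fun i _ =>
      hq.opAt_sum T (fun j _ => hq.isBoundedCoeff_opAt hf j) i
  have h2 : diffOn q T (diffOn q T f) = -diffOn q T (diffOn q T f) := by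
    conv_rhs => rw [h1, Finset.sum_comm]
    rw [h1, ← Finset.sum_neg_distrib]
    refine Finset.sum_congr rfl fun i _ => ?_
    rw [← Finset.sum_neg_distrib]
    refine Finset.sum_congr rfl fun j _ => ?_
    by_cases hij : i = j
    · subst hij; rw [hq.opAt_opAt_self, neg_zero]
    · exact hq.opAt_anticomm hf hij
  exact self_eq_neg.mp h2

end IsDifferentialKernel

theorem opAt_weight {i : Fin d} {K : (Fin d → Letter N) → Letter N → Letter N → ℂ}
    {c : (Fin d → Letter N) → ℂ} {c' : ℂ} {v : Fin d → Letter N}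
    (h : ∀ y, K v y (v i) ≠ 0 → c (Function.update v i y) = c') (f : (Fin d → Letter N) → ℂ) :
    opAt i K (fun u => c u * f u) v = c' * opAt i K f v := by
  unfold opAt
  rw [mul_left_comm]
  congr 1
  rw [← tsum_mul_left]
  refine tsum_congr fun y => ?_
  by_cases hy : K v y (v i) = 0
  · simp [hy]
  · beta_reduce
    rw [h y hy]; ring

/-- A differential is compatible with weights that depend on quantities it preserves or changes
by a fixed amount. -/
theorem diffOn_weight {q : Letter N → Letter N → ℂ} {T : Finset (Fin d)}
    {c c' : (Fin d → Letter N) → ℂ}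
    (h : ∀ v, ∀ i ∈ T, ∀ y, q y (v i) ≠ 0 → c (Function.update v i y) = c' v)
    (f : (Fin d → Letter N) → ℂ) :
    diffOn q T (fun u => c u * f u) = fun v => c' v * diffOn q T f v := by
  funext v
  simp only [diffOn, Finset.sum_apply, Finset.mul_sum]
  exact Finset.sum_congr rfl fun i hi => opAt_weight (h v i hi) f

/-! ### The Koszul kernel and its left inverse -/

namespace Letter

/-- The site of a variable, with the junk value `0` for the constant fields. -/
def pos (x : Letter N) : ℤ := x.site.getD 0

/-- The fields `φ_s`, `χ̄_s`, which are the values of the Koszul differential. -/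
def isLow (s : Chirality) : Letter N → Bool
  | phi a _ => a = s
  | chibar a _ => a = s
  | _ => false

/-- The fields `χ_s`, `F_s`, on which the Koszul differential is not zero. -/
def isHigh (s : Chirality) : Letter N → Bool
  | chi a _ => a = s
  | F a _ => a = s
  | _ => false

/-- The field at site `m` whose differential involves the given low field. -/
def raise : Letter N → ℤ → Letter N
  | phi a _, m => chi a m
  | chibar a _, m => F a m
  | x, _ => x

/-- The field at site `m` that occurs in the differential of the given high field. -/
def lower : Letter N → ℤ → Letter N
  | chi a _, m => phi a m
  | F a _, m => chibar a m
  | x, _ => x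

/-- The factor `±i` with which a low field occurs in the differential. -/
noncomputable def coef : Letter N → ℂ
  | phi .plus _ => Complex.I
  | _ => -Complex.I

/-- The distance of a variable from the site `a`, zero for the constant fields. -/
def siteDist (a : ℤ) (x : Letter N) : ℝ :=
  match x.site with
  | some n => |((n - a : ℤ) : ℝ)|
  | none => 0

theorem siteDist_nonneg (a : ℤ) (x : Letter N) : 0 ≤ x.siteDist a := by
  unfold siteDist; split <;> simp

theorem norm_coef (x : Letter N) : ‖x.coef‖ = 1 := by
  unfold coef; split <;> simp

theorem coef_ne_zero (x : Letter N) : x.coef ≠ 0 := by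
  rw [← norm_ne_zero_iff, norm_coef]; exact one_ne_zero

theorem parity_shift (a : ℤ) (x : Letter N) : (x.shift a).parity = x.parity := by
  cases x <;> rfl

end Letter

open Letter

/-- The kernel of the supercharge of the opposite type on functionals of the variables of type `s`,
where it acts as a Koszul differential. -/
noncomputable def koszulKernel (D : ℤ → ℂ) (s : Chirality) (y x : Letter N) : ℂ :=
  if x.isLow s ∧ y = x.raise y.pos then x.coef * D (y.pos - x.pos) else 0

/-- The kernel that divides by the lattice difference operator, by means of a kernel `h` for
sequences that is centred at the site `a`. -/
noncomputable def divisionKernel (h : ℤ → ℤ → ℂ) (s : Chirality) (a : ℤ) (y x : Letter N) : ℂ :=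
  if x.isHigh s ∧ y = x.lower y.pos then y.coef⁻¹ * h (x.pos - a) (y.pos - a) else 0

theorem hasSum_letter_iff {α : Type*} [AddCommMonoid α] [TopologicalSpace α] {e : ℤ → Letter N}
    (he : ∀ m, (e m).pos = m) {g : Letter N → α} (hg : ∀ y, y ≠ e y.pos → g y = 0) {a : α} :
    HasSum (fun m => g (e m)) a ↔ HasSum g a := by
  refine Function.Injective.hasSum_iff (g := e) (fun m n h => ?_) fun y hy => hg y fun h => hy ?_
  · rw [← he m, ← he n, h]
  · exact ⟨_, h.symm⟩

theorem summable_letter_iff {α : Type*} [AddCommMonoid α] [TopologicalSpace α] {e : ℤ → Letter N}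
    (he : ∀ m, (e m).pos = m) {g : Letter N → α} (hg : ∀ y, y ≠ e y.pos → g y = 0) :
    Summable (fun m => g (e m)) ↔ Summable g :=
  exists_congr fun _ => hasSum_letter_iff he hg

theorem tsum_letter_eq {α : Type*} [AddCommMonoid α] [TopologicalSpace α] [T2Space α]
    {e : ℤ → Letter N}
    (he : ∀ m, (e m).pos = m) {g : Letter N → α} (hg : ∀ y, y ≠ e y.pos → g y = 0) :
    ∑' y, g y = ∑' m, g (e m) := by
  refine (Function.Injective.tsum_eq (f := g) (g := e) (fun m n h => ?_) fun y hy => ?_).symm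
  · rw [← he m, ← he n, h]
  · by_contra h
    exact hy (hg y fun h' => h ⟨_, h'.symm⟩)

theorem pos_raise {s : Chirality} {x : Letter N} (hx : x.isLow s) (m : ℤ) :
    (x.raise m).pos = m := by
  cases x <;> simp_all [isLow, raise, pos, site]

theorem pos_lower {s : Chirality} {x : Letter N} (hx : x.isHigh s) (m : ℤ) :
    (x.lower m).pos = m := by
  cases x <;> simp_all [isHigh, lower, pos, site]

theorem koszulKernel_raise {D : ℤ → ℂ} {s : Chirality} {x : Letter N} (hx : x.isLow s) (m : ℤ) :
    koszulKernel D s (x.raise m) x = x.coef * D (m - x.pos) := by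
  simp [koszulKernel, hx, pos_raise hx]

theorem koszulKernel_of_ne {D : ℤ → ℂ} {s : Chirality} {x y : Letter N} (h : y ≠ x.raise y.pos) :
    koszulKernel D s y x = 0 := by
  simp [koszulKernel, h]

theorem koszulKernel_of_not_isLow {D : ℤ → ℂ} {s : Chirality} {x y : Letter N}
    (h : ¬ x.isLow s) : koszulKernel D s y x = 0 := by
  simp [koszulKernel, h]

theorem divisionKernel_lower {h : ℤ → ℤ → ℂ} {s : Chirality} {a : ℤ} {x : Letter N}
    (hx : x.isHigh s) (m : ℤ) :
    divisionKernel h s a (x.lower m) x = (x.lower m).coef⁻¹ * h (x.pos - a) (m - a) := by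
  simp [divisionKernel, hx, pos_lower hx]

theorem divisionKernel_of_ne {h : ℤ → ℤ → ℂ} {s : Chirality} {a : ℤ} {x y : Letter N}
    (hy : y ≠ x.lower y.pos) : divisionKernel h s a y x = 0 := by
  simp [divisionKernel, hy]

theorem divisionKernel_of_not_isHigh {h : ℤ → ℤ → ℂ} {s : Chirality} {a : ℤ} {x y : Letter N}
    (hx : ¬ x.isHigh s) : divisionKernel h s a y x = 0 := by
  simp [divisionKernel, hx]

theorem koszulKernel_ne_zero {D : ℤ → ℂ} {s : Chirality} {x y : Letter N}
    (h : koszulKernel D s y x ≠ 0) : x.isLow s ∧ y = x.raise y.pos := by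
  by_contra hn
  exact h (by simp only [koszulKernel, if_neg hn])

theorem divisionKernel_ne_zero {h : ℤ → ℤ → ℂ} {s : Chirality} {a : ℤ} {x y : Letter N}
    (hn : divisionKernel h s a y x ≠ 0) : x.isHigh s ∧ y = x.lower y.pos := by
  by_contra hn'
  exact hn (by simp only [divisionKernel, if_neg hn'])

theorem koszulKernel_shift (D : ℤ → ℂ) (s : Chirality) (c : ℤ) (x y : Letter N) :
    koszulKernel D s (y.shift c) (x.shift c) = koszulKernel D s y x := by
  cases x <;> cases y <;> simp [koszulKernel, shift, isLow, raise, pos, site]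
  all_goals
    rename_i a _ _ _
    cases a <;> rfl

theorem divisionKernel_shift (h : ℤ → ℤ → ℂ) (s : Chirality) (a c : ℤ) (x y : Letter N) :
    divisionKernel h s (a + c) (y.shift c) (x.shift c) = divisionKernel h s a y x := by
  cases x <;> cases y <;> simp [divisionKernel, shift, isHigh, lower, pos, site]
  all_goals
    rename_i _ _ a _
    cases a <;> rfl

theorem isOddKernel_koszulKernel (D : ℤ → ℂ) (s : Chirality) :
    IsOddKernel (koszulKernel (N := N) D s) := by
  intro y x h
  obtain ⟨h1, h2⟩ := koszulKernel_ne_zero h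
  rw [h2]
  clear h2 h
  cases x <;> simp_all [isLow, raise, parity, isOdd]

theorem isOddKernel_divisionKernel (h : ℤ → ℤ → ℂ) (s : Chirality) (a : ℤ) :
    IsOddKernel (divisionKernel (N := N) h s a) := by
  intro y x hn
  obtain ⟨h1, h2⟩ := divisionKernel_ne_zero hn
  rw [h2]
  clear h2 hn
  cases x <;> simp_all [isHigh, lower, parity, isOdd]

theorem isHigh_of_koszulKernel_ne_zero {D : ℤ → ℂ} {s : Chirality} {x y : Letter N}
    (h : koszulKernel D s y x ≠ 0) : y.isHigh s := by
  obtain ⟨h1, h2⟩ := koszulKernel_ne_zero h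
  rw [h2]
  clear h2 h
  cases x <;> simp_all [isLow, raise, isHigh]

theorem not_isHigh_of_isLow {s : Chirality} {x : Letter N} (h : x.isLow s) :
    x.isHigh s = false := by
  cases x <;> simp_all [isLow, isHigh]

theorem not_isLow_of_isHigh {s : Chirality} {x : Letter N} (h : x.isHigh s) :
    x.isLow s = false := by
  cases x <;> simp_all [isLow, isHigh]

theorem siteDist_eq_of_isLow {s : Chirality} {x : Letter N} (h : x.isLow s) (a : ℤ) :
    x.siteDist a = |((x.pos - a : ℤ) : ℝ)| := by
  cases x <;> simp_all [isLow, siteDist, site, pos]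

theorem siteDist_eq_of_isHigh {s : Chirality} {x : Letter N} (h : x.isHigh s) (a : ℤ) :
    x.siteDist a = |((x.pos - a : ℤ) : ℝ)| := by
  cases x <;> simp_all [isHigh, siteDist, site, pos]

theorem isHigh_raise {s : Chirality} {x : Letter N} (h : x.isLow s) (m : ℤ) :
    (x.raise m).isHigh s := by
  cases x <;> simp_all [isLow, raise, isHigh]

theorem isLow_lower {s : Chirality} {x : Letter N} (h : x.isHigh s) (m : ℤ) :
    (x.lower m).isLow s := by
  cases x <;> simp_all [isLow, lower, isHigh]

theorem raise_lower_pos {s : Chirality} {x : Letter N} (h : x.isHigh s) (m : ℤ) :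
    (x.lower m).raise x.pos = x := by
  cases x <;> simp_all [raise, lower, isHigh, pos, site]

theorem raise_lower {s : Chirality} {x : Letter N} (h : x.isHigh s) (b b' m : ℤ) :
    (x.lower b).raise m = (x.lower b').raise m := by
  cases x <;> simp_all [raise, lower, isHigh]

/-- The Koszul kernel is summable even with a small exponential weight. -/
theorem exists_koszulKernel_bound {D : ℤ → ℂ} (hD : IsDifferenceOperator D) (s : Chirality) :
    ∃ μ A : ℝ, 0 < μ ∧ 0 < A ∧ ∀ c ≤ μ, ∀ x : Letter N,
      (Summable fun y => ‖koszulKernel D s y x‖ * Real.exp (c * |((y.pos - x.pos : ℤ) : ℝ)|)) ∧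
      ∑' y, ‖koszulKernel D s y x‖ * Real.exp (c * |((y.pos - x.pos : ℤ) : ℝ)|) ≤ A := by
  obtain ⟨L, M, hL, hM, hDb⟩ := hD.isLocal
  have hM2 : 0 < M / 2 := by positivity
  have hS := (summable_exp_neg_mul_abs hM2).mul_left L
  refine ⟨M / 2, (∑' k : ℤ, L * Real.exp (-(M / 2) * |(k : ℝ)|)) + 1, hM2, ?_, fun c hc x => ?_⟩
  · have : 0 ≤ ∑' k : ℤ, L * Real.exp (-(M / 2) * |(k : ℝ)|) :=
      tsum_nonneg fun k => by positivity
    linarith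
  by_cases hx : x.isLow s
  · have he : ∀ m, (x.raise m).pos = m := pos_raise hx
    have hg : ∀ y : Letter N, y ≠ x.raise y.pos →
        ‖koszulKernel D s y x‖ * Real.exp (c * |((y.pos - x.pos : ℤ) : ℝ)|) = 0 := by
      intro y hy
      rw [koszulKernel_of_ne hy, norm_zero, zero_mul]
    have hle : ∀ m : ℤ, ‖koszulKernel D s (x.raise m) x‖ *
        Real.exp (c * |(((x.raise m).pos - x.pos : ℤ) : ℝ)|) ≤
        L * Real.exp (-(M / 2) * |((m - x.pos : ℤ) : ℝ)|) := by
      intro m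
      rw [koszulKernel_raise hx, norm_mul, norm_coef, one_mul, he]
      calc _ ≤ (L * Real.exp (-M * |((m - x.pos : ℤ) : ℝ)|)) *
            Real.exp (M / 2 * |((m - x.pos : ℤ) : ℝ)|) := by
            gcongr
            exact hDb _
        _ = _ := by rw [mul_assoc, ← Real.exp_add]; ring_nf
    have hS' : Summable fun m : ℤ => L * Real.exp (-(M / 2) * |((m - x.pos : ℤ) : ℝ)|) :=
      hS.comp_injective (sub_left_injective (b := x.pos))
    have hsum : Summable fun m : ℤ => ‖koszulKernel D s (x.raise m) x‖ *
        Real.exp (c * |(((x.raise m).pos - x.pos : ℤ) : ℝ)|) :=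
      Summable.of_nonneg_of_le (fun m => by positivity) hle hS'
    refine ⟨(summable_letter_iff he hg).mp hsum, ?_⟩
    rw [tsum_letter_eq he hg]
    have h1 := hsum.tsum_le_tsum hle hS'
    have h2 : ∑' m : ℤ, L * Real.exp (-(M / 2) * |((m - x.pos : ℤ) : ℝ)|) =
        ∑' k : ℤ, L * Real.exp (-(M / 2) * |(k : ℝ)|) :=
      (Equiv.subRight x.pos).tsum_eq fun k : ℤ => L * Real.exp (-(M / 2) * |(k : ℝ)|)
    linarith
  · have : ∀ y, koszulKernel D s y x = 0 := fun y => koszulKernel_of_not_isLow hx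
    simp only [this, norm_zero, zero_mul, tsum_zero]
    refine ⟨summable_zero, ?_⟩
    have : 0 ≤ ∑' k : ℤ, L * Real.exp (-(M / 2) * |(k : ℝ)|) :=
      tsum_nonneg fun k => by positivity
    linarith

theorem isDifferentialKernel_koszulKernel {D : ℤ → ℂ} (hD : IsDifferenceOperator D)
    (s : Chirality) : IsDifferentialKernel (koszulKernel (N := N) D s) := by
  obtain ⟨μ, A, hμ, hA, h⟩ := exists_koszulKernel_bound (N := N) hD s
  have h0 := h 0 hμ.le
  simp only [zero_mul, Real.exp_zero, mul_one] at h0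
  refine ⟨isOddKernel_koszulKernel D s, fun x y z hyx => ?_, fun x => (h0 x).1, A,
    fun x => (h0 x).2⟩
  refine koszulKernel_of_not_isLow ?_
  rw [not_isLow_of_isHigh (isHigh_of_koszulKernel_ne_zero hyx)]
  exact Bool.false_ne_true

/-- A family of kernels `k a`, centred at the sites `a`, that takes coefficients of decay rate `M`
to coefficients of decay rate `t`. -/
def KernelDecay (k : ℤ → Letter N → Letter N → ℂ) (M t : ℝ) : Prop :=
  ∃ A, 0 < A ∧ ∀ a x, (Summable fun y => ‖k a y x‖ * Real.exp (-M * y.siteDist a)) ∧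
    ∑' y, ‖k a y x‖ * Real.exp (-M * y.siteDist a) ≤ A * Real.exp (-t * x.siteDist a)

theorem exists_kernelDecay_koszulKernel {D : ℤ → ℂ} (hD : IsDifferenceOperator D)
    (s : Chirality) : ∃ μ, 0 < μ ∧ ∀ M, 0 ≤ M → M ≤ μ →
      KernelDecay (fun _ => koszulKernel (N := N) D s) M M := by
  obtain ⟨μ, A, hμ, hA, h⟩ := exists_koszulKernel_bound (N := N) hD s
  refine ⟨μ, hμ, fun M hM0 hM => ⟨A, hA, fun a x => ?_⟩⟩
  obtain ⟨h1, h2⟩ := h M hM x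
  have hle : ∀ y, ‖koszulKernel D s y x‖ * Real.exp (-M * y.siteDist a) ≤
      ‖koszulKernel D s y x‖ * Real.exp (M * |((y.pos - x.pos : ℤ) : ℝ)|) *
        Real.exp (-M * x.siteDist a) := by
    intro y
    by_cases hy : koszulKernel D s y x = 0
    · simp [hy]
    · rw [mul_assoc, ← Real.exp_add, siteDist_eq_of_isHigh (isHigh_of_koszulKernel_ne_zero hy),
        siteDist_eq_of_isLow (koszulKernel_ne_zero hy).1]
      gcongr
      have : |((x.pos - a : ℤ) : ℝ)| ≤
          |((y.pos - x.pos : ℤ) : ℝ)| + |((y.pos - a : ℤ) : ℝ)| := by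
        have := abs_sub_le (x.pos : ℝ) y.pos a
        rw [abs_sub_comm (x.pos : ℝ) y.pos] at this
        push_cast; exact this
      nlinarith
  have hs : Summable fun y => ‖koszulKernel D s y x‖ * Real.exp (-M * y.siteDist a) :=
    Summable.of_nonneg_of_le (fun y => by positivity) hle (h1.mul_right _)
  refine ⟨hs, (hs.tsum_le_tsum hle (h1.mul_right _)).trans ?_⟩
  rw [tsum_mul_right]
  gcongr

theorem kernelDecay_divisionKernel {h : ℤ → ℤ → ℂ} {K t M : ℝ} (hK : 0 < K) (htM : t < M)
    (hh : ∀ n b, ‖h n b‖ ≤ K * (Real.exp (-t * |(n : ℝ)|) * Real.exp (t * |(b : ℝ)|)))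
    (s : Chirality) : KernelDecay (divisionKernel (N := N) h s) M t := by
  have hS := (summable_exp_neg_mul_abs (sub_pos.mpr htM)).mul_left K
  set Z := ∑' k : ℤ, K * Real.exp (-(M - t) * |(k : ℝ)|) with hZ
  have hZ0 : 0 ≤ Z := tsum_nonneg fun k => by positivity
  refine ⟨Z + 1, by positivity, fun a x => ?_⟩
  by_cases hx : x.isHigh s
  · have he : ∀ m, (x.lower m).pos = m := pos_lower hx
    have hg : ∀ y : Letter N, y ≠ x.lower y.pos →
        ‖divisionKernel h s a y x‖ * Real.exp (-M * y.siteDist a) = 0 := by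
      intro y hy
      rw [divisionKernel_of_ne hy, norm_zero, zero_mul]
    have hle : ∀ m : ℤ, ‖divisionKernel h s a (x.lower m) x‖ *
        Real.exp (-M * (x.lower m).siteDist a) ≤
        K * Real.exp (-(M - t) * |((m - a : ℤ) : ℝ)|) * Real.exp (-t * x.siteDist a) := by
      intro m
      rw [divisionKernel_lower hx, norm_mul, norm_inv, norm_coef, inv_one, one_mul,
        siteDist_eq_of_isLow (isLow_lower hx m), he, siteDist_eq_of_isHigh hx]
      calc _ ≤ K * (Real.exp (-t * |((x.pos - a : ℤ) : ℝ)|) *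
            Real.exp (t * |((m - a : ℤ) : ℝ)|)) * Real.exp (-M * |((m - a : ℤ) : ℝ)|) := by
            gcongr
            exact hh _ _
        _ = _ := by
          rw [mul_assoc, mul_assoc, mul_assoc, ← Real.exp_add, ← Real.exp_add, ← Real.exp_add]
          ring_nf
    have hS' : Summable fun m : ℤ =>
        K * Real.exp (-(M - t) * |((m - a : ℤ) : ℝ)|) * Real.exp (-t * x.siteDist a) :=
      (hS.comp_injective (sub_left_injective (b := a))).mul_right _
    have hsum := Summable.of_nonneg_of_le (fun m => by positivity) hle hS'
    refine ⟨(summable_letter_iff he hg).mp hsum, ?_⟩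
    rw [tsum_letter_eq he hg]
    refine (hsum.tsum_le_tsum hle hS').trans ?_
    rw [tsum_mul_right]
    have h2 : ∑' m : ℤ, K * Real.exp (-(M - t) * |((m - a : ℤ) : ℝ)|) = Z :=
      (Equiv.subRight a).tsum_eq fun k : ℤ => K * Real.exp (-(M - t) * |(k : ℝ)|)
    rw [h2]
    gcongr
    linarith
  · have : ∀ y, divisionKernel h s a y x = 0 := fun y => divisionKernel_of_not_isHigh hx
    simp only [this, norm_zero, zero_mul, tsum_zero]
    exact ⟨summable_zero, by positivity⟩

theorem tsum_kernel_mul_difference {h : ℤ → ℤ → ℂ} {D F : ℤ → ℂ} {K t L M B R : ℝ}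
    (hK : 0 < K) (hL : 0 < L) (ht : 0 < t) (htM : t < M) (htR : t < R)
    (hh : ∀ n b, ‖h n b‖ ≤ K * (Real.exp (-t * |(n : ℝ)|) * Real.exp (t * |(b : ℝ)|)))
    (hinv : ∀ n m, HasSum (fun b => h n b * D (m - b)) (if m = n then 1 else 0))
    (hD : ∀ k : ℤ, ‖D k‖ ≤ L * Real.exp (-M * |(k : ℝ)|)) (a n : ℤ)
    (hF : ∀ m : ℤ, ‖F m‖ ≤ B * Real.exp (-R * |((m - a : ℤ) : ℝ)|)) :
    ∑' b : ℤ, h (n - a) (b - a) * ∑' m : ℤ, D (m - b) * F m = F n := by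
  have hB : 0 ≤ B := by
    have := (norm_nonneg _).trans (hF a)
    simpa using this
  have hsum : Summable fun p : ℤ × ℤ => h (n - a) (p.1 - a) * (D (p.2 - p.1) * F p.2) := by
    have hs1 := (summable_exp_neg_mul_abs (sub_pos.mpr htR)).mul_of_nonneg
      (summable_exp_neg_mul_abs (sub_pos.mpr htM)) (fun _ => by positivity)
      (fun _ => by positivity)
    have hs2 := (hs1.comp_injective (i := fun p : ℤ × ℤ => (p.2 - a, p.2 - p.1))
      (by rintro ⟨x, y⟩ ⟨x', y'⟩ hxy; simp at hxy ⊢; omega)).mul_left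
        (K * Real.exp (-t * |((n - a : ℤ) : ℝ)|) * L * B)
    refine Summable.of_norm_bounded hs2 fun p => ?_
    rw [norm_mul, norm_mul]
    have hb : |((p.1 - a : ℤ) : ℝ)| ≤ |((p.2 - a : ℤ) : ℝ)| + |((p.2 - p.1 : ℤ) : ℝ)| := by
      have := abs_sub_le (p.1 : ℝ) p.2 a
      rw [abs_sub_comm (p.1 : ℝ) p.2] at this
      push_cast; linarith
    calc _ ≤ (K * (Real.exp (-t * |((n - a : ℤ) : ℝ)|) *
            Real.exp (t * (|((p.2 - a : ℤ) : ℝ)| + |((p.2 - p.1 : ℤ) : ℝ)|)))) *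
          ((L * Real.exp (-M * |((p.2 - p.1 : ℤ) : ℝ)|)) *
            (B * Real.exp (-R * |((p.2 - a : ℤ) : ℝ)|))) := by
          gcongr
          · refine (hh _ _).trans ?_
            gcongr
          · exact hD _
          · exact hF _
      _ = K * Real.exp (-t * |((n - a : ℤ) : ℝ)|) * L * B *
          (Real.exp (t * (|((p.2 - a : ℤ) : ℝ)| + |((p.2 - p.1 : ℤ) : ℝ)|)) *
            Real.exp (-M * |((p.2 - p.1 : ℤ) : ℝ)|) *
            Real.exp (-R * |((p.2 - a : ℤ) : ℝ)|)) := by ring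
      _ = _ := by
          rw [← Real.exp_add, ← Real.exp_add]
          simp only [Function.comp]
          rw [← Real.exp_add]
          ring_nf
  simp_rw [← tsum_mul_left]
  rw [← Summable.tsum_comm (f := fun b m => h (n - a) (b - a) * (D (m - b) * F m)) hsum]
  have hin : ∀ m : ℤ, ∑' b : ℤ, h (n - a) (b - a) * (D (m - b) * F m) =
      if m = n then F n else 0 := by
    intro m
    have h1 := ((Equiv.subRight a).hasSum_iff.mpr (hinv (n - a) (m - a))).mul_right (F m)
    have h2 : (fun b : ℤ => h (n - a) (b - a) * (D (m - b) * F m)) = fun b =>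
        ((fun b => h (n - a) b * D (m - a - b)) ∘ (Equiv.subRight a)) b * F m := by
      funext b
      simp [mul_assoc]
    rw [h2, h1.tsum_eq]
    by_cases hmn : m = n
    · simp [hmn]
    · simp [hmn, sub_left_inj]
  simp_rw [hin]
  exact tsum_ite_eq n _

/-- On coefficients that decay exponentially, the division kernel is a left inverse of the Koszul
kernel. -/
theorem tsum_divisionKernel_koszulKernel {h : ℤ → ℤ → ℂ} {D : ℤ → ℂ} {K t L M B R : ℝ}
    (hK : 0 < K) (hL : 0 < L) (ht : 0 < t) (htM : t < M) (htR : t < R)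
    (hh : ∀ n b, ‖h n b‖ ≤ K * (Real.exp (-t * |(n : ℝ)|) * Real.exp (t * |(b : ℝ)|)))
    (hinv : ∀ n m, HasSum (fun b => h n b * D (m - b)) (if m = n then 1 else 0))
    (hD : ∀ k : ℤ, ‖D k‖ ≤ L * Real.exp (-M * |(k : ℝ)|)) {s : Chirality} (a : ℤ)
    {x : Letter N} (hx : x.isHigh s) {F : Letter N → ℂ}
    (hF : ∀ y : Letter N, ‖F y‖ ≤ B * Real.exp (-R * y.siteDist a)) :
    ∑' y, divisionKernel h s a y x * ∑' z, koszulKernel D s z y * F z = F x := by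
  have he : ∀ m, (x.lower m).pos = m := pos_lower hx
  rw [tsum_letter_eq he fun y hy => by rw [divisionKernel_of_ne hy, zero_mul]]
  have key := tsum_kernel_mul_difference (F := fun m => F ((x.lower 0).raise m)) (B := B)
    hK hL ht htM htR hh hinv hD a x.pos
    (fun m => by
      have := hF ((x.lower 0).raise m)
      rwa [siteDist_eq_of_isHigh (isHigh_raise (isLow_lower hx 0) m),
        pos_raise (isLow_lower hx 0)] at this)
  rw [raise_lower_pos hx] at key
  rw [← key]
  refine tsum_congr fun b => ?_
  have hl := isLow_lower hx b
  rw [divisionKernel_lower hx, tsum_letter_eq (pos_raise hl)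
    fun y hy => by rw [koszulKernel_of_ne hy, zero_mul]]
  simp_rw [koszulKernel_raise hl, he, raise_lower hx b 0, mul_assoc, tsum_mul_left]
  rw [mul_left_comm (h _ _), inv_mul_cancel_left₀ (coef_ne_zero _)]

/-! ### Coefficients that are local relative to a reference factor -/

/-- The total distance of the factors of a monomial from the site `a`. -/
noncomputable def spread (a : ℤ) (v : Fin d → Letter N) : ℝ := ∑ i, (v i).siteDist a

theorem spread_nonneg (a : ℤ) (v : Fin d → Letter N) : 0 ≤ spread a v :=
  Finset.sum_nonneg fun _ _ => siteDist_nonneg _ _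

theorem siteDist_le_spread (a : ℤ) (v : Fin d → Letter N) (i : Fin d) :
    (v i).siteDist a ≤ spread a v :=
  Finset.single_le_sum (f := fun i => (v i).siteDist a) (fun _ _ => siteDist_nonneg _ _)
    (Finset.mem_univ i)

theorem spread_update (a : ℤ) (v : Fin d → Letter N) (i : Fin d) (y : Letter N) :
    spread a (Function.update v i y) =
      y.siteDist a + ∑ j ∈ Finset.univ.erase i, (v j).siteDist a := by
  unfold spread
  rw [← Finset.add_sum_erase _ _ (Finset.mem_univ i), Function.update_self]
  congr 1
  exact Finset.sum_congr rfl fun j hj => by rw [Function.update_of_ne (Finset.ne_of_mem_erase hj)]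

theorem spread_eq (a : ℤ) (v : Fin d → Letter N) (i : Fin d) :
    spread a v = (v i).siteDist a + ∑ j ∈ Finset.univ.erase i, (v j).siteDist a :=
  (Finset.add_sum_erase _ _ (Finset.mem_univ i)).symm

/-- Exponential decay, with rate `M`, in the distances from the `p`-th factor. -/
def DecaysAt (p : Fin d) (M : ℝ) (f : (Fin d → Letter N) → ℂ) : Prop :=
  ∃ L, 0 < L ∧ ∀ v, ‖f v‖ ≤ L * Real.exp (-M * spread (v p).pos v)

/-- Coefficients, without any symmetry, that live on monomials whose `p`-th factor has a site, are
translation invariant, and decay exponentially in the distances from the `p`-th factor. -/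
structure IsLocalAt (p : Fin d) (f : (Fin d → Letter N) → ℂ) : Prop where
  sited : ∀ v, (v p).site = none → f v = 0
  shift : ∀ a v, f (fun i => (v i).shift a) = f v
  decay : ∃ M, 0 < M ∧ DecaysAt p M f

theorem DecaysAt.mono {p : Fin d} {M M' : ℝ} {f : (Fin d → Letter N) → ℂ} (hf : DecaysAt p M f)
    (h : M' ≤ M) : DecaysAt p M' f := by
  obtain ⟨L, hL, hb⟩ := hf
  refine ⟨L, hL, fun v => (hb v).trans ?_⟩
  have := spread_nonneg (v p).pos v
  gcongr

theorem DecaysAt.sub {p : Fin d} {M : ℝ} {f g : (Fin d → Letter N) → ℂ} (hf : DecaysAt p M f)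
    (hg : DecaysAt p M g) : DecaysAt p M (f - g) := by
  obtain ⟨L, hL, hb⟩ := hf
  obtain ⟨L', hL', hb'⟩ := hg
  refine ⟨L + L', by positivity, fun v => (norm_sub_le _ _).trans ?_⟩
  rw [add_mul]
  exact add_le_add (hb v) (hb' v)

theorem norm_update_le {p i : Fin d} (hi : i ≠ p) {L M : ℝ} {f : (Fin d → Letter N) → ℂ}
    (hb : ∀ v, ‖f v‖ ≤ L * Real.exp (-M * spread (v p).pos v)) (v : Fin d → Letter N)
    (y : Letter N) :
    ‖f (Function.update v i y)‖ ≤ Real.exp (-M * y.siteDist (v p).pos) *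
      (L * Real.exp (-M * ∑ j ∈ Finset.univ.erase i, (v j).siteDist (v p).pos)) := by
  have h1 := hb (Function.update v i y)
  rw [Function.update_of_ne hi.symm, spread_update, mul_add, Real.exp_add] at h1
  linarith

theorem DecaysAt.summable_kernel {p i : Fin d} (hi : i ≠ p) {k : ℤ → Letter N → Letter N → ℂ}
    {M t : ℝ} (hk : KernelDecay k M t) {f : (Fin d → Letter N) → ℂ} (hf : DecaysAt p M f)
    (v : Fin d → Letter N) (x : Letter N) :
    Summable fun y => k (v p).pos y x * f (Function.update v i y) := by
  obtain ⟨L, hL, hb⟩ := hf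
  obtain ⟨A, hA, hk⟩ := hk
  refine Summable.of_norm_bounded ((hk (v p).pos x).1.mul_right
    (L * Real.exp (-M * ∑ j ∈ Finset.univ.erase i, (v j).siteDist (v p).pos))) fun y => ?_
  rw [norm_mul, mul_assoc]
  gcongr
  exact norm_update_le hi hb v y

theorem DecaysAt.opAt {p i : Fin d} (hi : i ≠ p) {k : ℤ → Letter N → Letter N → ℂ}
    {M t : ℝ} (htM : t ≤ M) (hk : KernelDecay k M t) {f : (Fin d → Letter N) → ℂ}
    (hf : DecaysAt p M f) : DecaysAt p t (opAt i (fun v => k (v p).pos) f) := by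
  obtain ⟨L, hL, hb⟩ := hf
  obtain ⟨A, hA, hk⟩ := hk
  refine ⟨A * L, by positivity, fun v => ?_⟩
  unfold LatticeSUSY.opAt
  rw [norm_mul, norm_leftSign, one_mul]
  set r := ∑ j ∈ Finset.univ.erase i, (v j).siteDist (v p).pos with hr
  have hr0 : 0 ≤ r := Finset.sum_nonneg fun _ _ => siteDist_nonneg _ _
  refine (tsum_of_norm_bounded ((hk (v p).pos (v i)).1.hasSum.mul_right
    (L * Real.exp (-M * r))) fun y => ?_).trans ?_
  · rw [norm_mul, mul_assoc]
    gcongr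
    exact norm_update_le hi hb v y
  · calc _ ≤ A * Real.exp (-t * (v i).siteDist (v p).pos) * (L * Real.exp (-t * r)) := by
          gcongr
          exact (hk _ _).2
      _ = _ := by
          rw [spread_eq _ v i, mul_add, Real.exp_add]; ring

/-- Translation of the variables by `c`, as a bijection. -/
def shiftEquiv (c : ℤ) : Letter N ≃ Letter N where
  toFun := Letter.shift c
  invFun := Letter.shift (-c)
  left_inv x := by cases x <;> simp [Letter.shift]
  right_inv x := by cases x <;> simp [Letter.shift]

theorem leftSign_shift (c : ℤ) (v : Fin d → Letter N) (i : Fin d) :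
    leftSign (fun j => (v j).shift c) i = leftSign v i := by
  simp only [leftSign, parity_shift]

theorem update_shift (c : ℤ) (v : Fin d → Letter N) (i : Fin d) (y : Letter N) :
    Function.update (fun j => (v j).shift c) i (y.shift c) =
      fun j => (Function.update v i y j).shift c := by
  funext j
  by_cases h : j = i
  · subst h; simp
  · simp [h]

theorem opAt_shift {i : Fin d} {K : (Fin d → Letter N) → Letter N → Letter N → ℂ}
    {f : (Fin d → Letter N) → ℂ} (hf : ∀ a v, f (fun i => (v i).shift a) = f v) (c : ℤ)
    (v : Fin d → Letter N)
    (hK : ∀ y, f (Function.update v i y) ≠ 0 →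
      K (fun j => (v j).shift c) (y.shift c) ((v i).shift c) = K v y (v i)) :
    opAt i K f (fun j => (v j).shift c) = opAt i K f v := by
  unfold opAt
  rw [leftSign_shift, ← (shiftEquiv c).tsum_eq]
  congr 1
  refine tsum_congr fun y => ?_
  simp only [shiftEquiv, Equiv.coe_fn_mk]
  rw [update_shift, hf]
  by_cases hy : f (Function.update v i y) = 0
  · rw [hy, mul_zero, mul_zero]
  · rw [hK y hy]

namespace IsLocalAt

variable {p : Fin d} {f g : (Fin d → Letter N) → ℂ}

theorem isBoundedCoeff (hf : IsLocalAt p f) : IsBoundedCoeff f := by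
  obtain ⟨M, hM, L, hL, hb⟩ := hf.decay
  refine ⟨L, fun v => (hb v).trans ?_⟩
  have := spread_nonneg (v p).pos v
  have h1 : Real.exp (-M * spread (v p).pos v) ≤ 1 := Real.exp_le_one_iff.mpr (by nlinarith)
  nlinarith

theorem zero : IsLocalAt p (0 : (Fin d → Letter N) → ℂ) :=
  ⟨fun _ _ => rfl, fun _ _ => rfl, 1, one_pos, 1, one_pos, fun v => by
    simp only [Pi.zero_apply, norm_zero]; positivity⟩

theorem sub (hf : IsLocalAt p f) (hg : IsLocalAt p g) : IsLocalAt p (f - g) := by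
  obtain ⟨M, hM, h1⟩ := hf.decay
  obtain ⟨M', hM', h2⟩ := hg.decay
  refine ⟨fun v h => ?_, fun a v => ?_, min M M', lt_min hM hM',
    (h1.mono (min_le_left _ _)).sub (h2.mono (min_le_right _ _))⟩
  · rw [Pi.sub_apply, hf.sited v h, hg.sited v h, sub_zero]
  · rw [Pi.sub_apply, hf.shift, hg.shift, Pi.sub_apply]

theorem sum {ι : Type*} (T : Finset ι) {f : ι → (Fin d → Letter N) → ℂ}
    (hf : ∀ i ∈ T, IsLocalAt p (f i)) : IsLocalAt p (∑ i ∈ T, f i) := by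
  classical
  induction T using Finset.induction_on with
  | empty => exact zero
  | insert a T ha ih =>
    rw [Finset.sum_insert ha]
    have := (hf a (Finset.mem_insert_self _ _)).sub
      (zero.sub (ih fun i hi => hf i (Finset.mem_insert_of_mem hi)))
    simpa using this

theorem weight (hf : IsLocalAt p f) {c : (Fin d → Letter N) → ℂ}
    (hc : ∀ a v, c (fun i => (v i).shift a) = c v) (hb : ∀ v, ‖c v‖ ≤ 1) :
    IsLocalAt p fun v => c v * f v := by
  obtain ⟨M, hM, L, hL, h⟩ := hf.decay
  refine ⟨fun v hv => by simp [hf.sited v hv], fun a v => by simp [hc, hf.shift], M, hM, L, hL,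
    fun v => ?_⟩
  rw [norm_mul]
  exact (mul_le_of_le_one_left (norm_nonneg _) (hb v)).trans (h v)

theorem opAt_sited (hf : IsLocalAt p f) {i : Fin d} (hi : i ≠ p)
    (K : (Fin d → Letter N) → Letter N → Letter N → ℂ) (v : Fin d → Letter N)
    (hv : (v p).site = none) : opAt i K f v = 0 := by
  unfold opAt
  have : ∀ y, f (Function.update v i y) = 0 := fun y =>
    hf.sited _ (by rwa [Function.update_of_ne hi.symm])
  simp [this]

theorem pos_shift_of_site {x : Letter N} (hx : x.site ≠ none) (c : ℤ) :
    (x.shift c).pos = x.pos + c := by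
  cases x <;> simp_all [pos, site, Letter.shift]

theorem opAt (hf : IsLocalAt p f) {i : Fin d} (hi : i ≠ p) {k : ℤ → Letter N → Letter N → ℂ}
    (hks : ∀ a c x y, k (a + c) (y.shift c) (x.shift c) = k a y x)
    {M t : ℝ} (ht : 0 < t) (htM : t ≤ M) (hk : KernelDecay k M t) (hfM : DecaysAt p M f) :
    IsLocalAt p (opAt i (fun v => k (v p).pos) f) := by
  refine ⟨fun v hv => hf.opAt_sited hi _ v hv, fun c v => ?_, t, ht, hfM.opAt hi htM hk⟩
  refine opAt_shift hf.shift c v fun y hy => ?_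
  have hp : (v p).site ≠ none := fun h => hy (hf.sited _ (by rwa [Function.update_of_ne hi.symm]))
  rw [pos_shift_of_site hp, hks]

theorem opAt_koszulKernel {D : ℤ → ℂ} (hD : IsDifferenceOperator D) (s : Chirality)
    (hf : IsLocalAt p f) {i : Fin d} (hi : i ≠ p) :
    IsLocalAt p (LatticeSUSY.opAt i (fun _ => koszulKernel D s) f) := by
  obtain ⟨M, hM, h⟩ := hf.decay
  obtain ⟨μ, hμ, hk⟩ := exists_kernelDecay_koszulKernel (N := N) hD s
  have hm : 0 < min M μ := lt_min hM hμ
  exact hf.opAt hi (k := fun _ => koszulKernel D s) (fun _ c x y => koszulKernel_shift D s c x y)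
    hm le_rfl (hk _ hm.le (min_le_right _ _)) (h.mono (min_le_left _ _))

theorem diffOn_koszulKernel {D : ℤ → ℂ} (hD : IsDifferenceOperator D) (s : Chirality)
    (hf : IsLocalAt p f) : IsLocalAt p (diffOn (koszulKernel D s) (Finset.univ.erase p) f) :=
  IsLocalAt.sum _ fun _ hi => hf.opAt_koszulKernel hD s (Finset.ne_of_mem_erase hi)

/-- The differential of the reference factor moves the reference site, which costs a part of the
decay rate. -/
theorem opAt_koszulKernel_self {D : ℤ → ℂ} (hD : IsDifferenceOperator D) (s : Chirality)
    (hf : IsLocalAt p f) : IsLocalAt p (LatticeSUSY.opAt p (fun _ => koszulKernel D s) f) := by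
  refine ⟨fun v hv => ?_, fun c v => ?_, ?_⟩
  · unfold LatticeSUSY.opAt
    have : ∀ y, koszulKernel D s y (v p) = 0 := fun y => koszulKernel_of_not_isLow (by
      revert hv; cases v p <;> simp [site, isLow])
    simp [this]
  · exact opAt_shift hf.shift c v fun y _ => koszulKernel_shift D s c _ _
  · obtain ⟨M, hM, L, hL, hb⟩ := hf.decay
    obtain ⟨μ, A, hμ, hA, hk⟩ := exists_koszulKernel_bound (N := N) hD s
    have hd : 0 < (d : ℝ) := by exact_mod_cast p.pos
    set t := min M (μ / d) with ht
    have ht0 : 0 < t := lt_min hM (by positivity)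
    have htd : t * d ≤ μ := (le_div_iff₀ hd).mp (min_le_right _ _)
    refine ⟨t, ht0, A * L, by positivity, fun v => ?_⟩
    unfold LatticeSUSY.opAt
    rw [norm_mul, norm_leftSign, one_mul]
    refine (tsum_of_norm_bounded ((hk (t * d) htd (v p)).1.hasSum.mul_right
      (L * Real.exp (-t * spread (v p).pos v))) fun y => ?_).trans ?_
    · rw [norm_mul]
      by_cases hy : koszulKernel D s y (v p) = 0
      · simp [hy]
      have h1 := hb (Function.update v p y)
      rw [Function.update_self] at h1
      have h2 : spread (v p).pos v ≤ spread y.pos (Function.update v p y) +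
          d * |((y.pos - (v p).pos : ℤ) : ℝ)| := by
        have : ∀ i, (v i).siteDist (v p).pos ≤ (Function.update v p y i).siteDist y.pos +
            |((y.pos - (v p).pos : ℤ) : ℝ)| := by
          intro i
          by_cases hi : i = p
          · subst hi
            rw [Function.update_self, siteDist_eq_of_isLow (koszulKernel_ne_zero hy).1, sub_self]
            have := siteDist_nonneg y.pos y
            simp only [Int.cast_zero, abs_zero]
            positivity
          · rw [Function.update_of_ne hi]
            unfold siteDist
            split
            · rename_i n _
              have := abs_sub_le (n : ℝ) y.pos (v p).pos
              push_cast; exact this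
            · positivity
        calc _ ≤ ∑ i, ((Function.update v p y i).siteDist y.pos +
              |((y.pos - (v p).pos : ℤ) : ℝ)|) := Finset.sum_le_sum fun i _ => this i
          _ = _ := by
            rw [Finset.sum_add_distrib, Finset.sum_const, Finset.card_univ, Fintype.card_fin,
              nsmul_eq_mul]; rfl
      have h3 := spread_nonneg y.pos (Function.update v p y)
      calc _ ≤ ‖koszulKernel D s y (v p)‖ * (L * Real.exp (t * d * |((y.pos - (v p).pos : ℤ) : ℝ)| +
            -t * spread (v p).pos v)) := by
            gcongr
            refine h1.trans ?_
            have h4 : -M * spread y.pos (Function.update v p y) ≤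
                t * d * |((y.pos - (v p).pos : ℤ) : ℝ)| + -t * spread (v p).pos v := by
              have : t ≤ M := min_le_left _ _
              nlinarith
            gcongr
        _ = _ := by rw [Real.exp_add]; ring
    · rw [mul_assoc]
      gcongr
      exact (hk _ htd _).2

end IsLocalAt

/-! ### Exactness of the Koszul complex -/

/-- Dividing the `j`-th factor by the difference operator inverts its differential on monomials
whose `j`-th factor is high. -/
theorem opAt_division_koszul {h : ℤ → ℤ → ℂ} {D : ℤ → ℂ} {K t L M R : ℝ}
    (hK : 0 < K) (hL : 0 < L) (ht : 0 < t) (htM : t < M) (htR : t < R)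
    (hh : ∀ n b, ‖h n b‖ ≤ K * (Real.exp (-t * |(n : ℝ)|) * Real.exp (t * |(b : ℝ)|)))
    (hinv : ∀ n m, HasSum (fun b => h n b * D (m - b)) (if m = n then 1 else 0))
    (hDb : ∀ k : ℤ, ‖D k‖ ≤ L * Real.exp (-M * |(k : ℝ)|)) {s : Chirality} {p j : Fin d}
    (hj : j ≠ p) {f : (Fin d → Letter N) → ℂ} (hf : DecaysAt p R f) (v : Fin d → Letter N) :
    opAt j (fun v => divisionKernel h s (v p).pos) (opAt j (fun _ => koszulKernel D s) f) v =
      if (v j).isHigh s then f v else 0 := by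
  split_ifs with hx
  · obtain ⟨B, hB, hb⟩ := hf
    have key := tsum_divisionKernel_koszulKernel (F := fun y => f (Function.update v j y))
      hK hL ht htM htR hh hinv hDb (v p).pos hx
      (B := B * Real.exp (-R * ∑ i ∈ Finset.univ.erase j, (v i).siteDist (v p).pos))
      (fun y => by rw [mul_comm]; exact norm_update_le hj hb v y)
    simp only [Function.update_eq_self] at key
    unfold opAt
    simp only [Function.update_self, Function.update_idem, leftSign_update_of_le v le_rfl]
    rw [← tsum_mul_left]
    calc _ = ∑' y, leftSign v j * leftSign v j * (divisionKernel h s (v p).pos y (v j) *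
          ∑' z, koszulKernel D s z y * f (Function.update v j z)) :=
          tsum_congr fun y => by ring
      _ = f v := by rw [tsum_mul_left, key, leftSign_mul_self, one_mul]
  · unfold opAt
    simp [divisionKernel_of_not_isHigh hx]

/-- One step of the construction of a primitive: dividing the `j`-th factor by the difference
operator solves the problem on monomials whose `j`-th factor is high, and creates no new terms with
another high factor. -/
theorem exists_primitive_step {D : ℤ → ℂ} (hD : IsDifferenceOperator D) (s : Chirality)
    {p j : Fin d} (hj : j ≠ p) {f : (Fin d → Letter N) → ℂ} (hf : IsLocalAt p f)
    (hclosed : diffOn (koszulKernel D s) (Finset.univ.erase p) f = 0) :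
    ∃ g, IsLocalAt p g ∧
      (∀ v, (v j).isHigh s → diffOn (koszulKernel D s) (Finset.univ.erase p) g v = f v) ∧
      ∀ i, i ≠ j → (∀ v, (v i).isHigh s → f v = 0) →
        ∀ v, (v i).isHigh s → diffOn (koszulKernel D s) (Finset.univ.erase p) g v = 0 := by
  obtain ⟨M₀, hM₀, hf₀⟩ := hf.decay
  obtain ⟨μ, hμ, hq⟩ := exists_kernelDecay_koszulKernel (N := N) hD s
  obtain ⟨L, MD, hL, hMD, hDb⟩ := hD.isLocal
  set M := min M₀ μ with hM
  have hM0 : 0 < M := lt_min hM₀ hμ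
  have hfM : DecaysAt p M f := hf₀.mono (min_le_left _ _)
  replace hq := hq M hM0.le (min_le_right _ _)
  obtain ⟨t, ht, htc, K, hK, h, hh, hinv⟩ := exists_left_inverse_kernel hD (lt_min hM0 hMD)
  have htM : t < M := htc.trans_le (min_le_left _ _)
  have htD : t < MD := htc.trans_le (min_le_right _ _)
  have hk : KernelDecay (divisionKernel (N := N) h s) M t :=
    kernelDecay_divisionKernel hK htM hh s
  set q := koszulKernel (N := N) D s with hqdef
  set H : (Fin d → Letter N) → Letter N → Letter N → ℂ :=
    fun v => divisionKernel h s (v p).pos with hH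
  have hjT : j ∈ Finset.univ.erase p := Finset.mem_erase.mpr ⟨hj, Finset.mem_univ _⟩
  have hg : IsLocalAt p (opAt j H f) :=
    hf.opAt hj (fun a c x y => divisionKernel_shift h s a c x y) ht htM.le hk hfM
  have hanti : ∀ i ∈ (Finset.univ.erase p).erase j,
      opAt i (fun _ => q) (opAt j H f) = -opAt j H (opAt i (fun _ => q) f) := by
    intro i hi
    have hij : i ≠ j := Finset.ne_of_mem_erase hi
    have hip : i ≠ p := Finset.ne_of_mem_erase (Finset.mem_of_mem_erase hi)
    funext v
    refine opAt_anticomm hij (isOddKernel_koszulKernel D s) (isOddKernel_divisionKernel h s _)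
      (fun _ => rfl) (fun y => ?_) ?_
    · simp only [hH, Function.update_of_ne hip.symm]
    · obtain ⟨B, hB, hb⟩ := hfM
      obtain ⟨A, hA, hk'⟩ := hk
      have hs := (((isDifferentialKernel_koszulKernel (N := N) hD s).summable (v i)).mul_of_nonneg
        (hk' (v p).pos (v j)).1 (fun _ => norm_nonneg _) (fun _ => by positivity)).mul_right B
      refine Summable.of_norm_bounded hs fun x => ?_
      have h1 := hb (Function.update (Function.update v i x.1) j x.2)
      have h2 := siteDist_le_spread (v p).pos
        (Function.update (Function.update v i x.1) j x.2) j
      rw [Function.update_of_ne hj.symm, Function.update_of_ne hip.symm] at h1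
      rw [Function.update_self] at h2
      rw [norm_mul, norm_mul, mul_assoc, mul_assoc, mul_assoc]
      gcongr
      refine h1.trans ?_
      rw [mul_comm]
      gcongr ?_ * _
      exact Real.exp_le_exp.mpr (by nlinarith)
  have hHsum : ∑ i ∈ (Finset.univ.erase p).erase j, opAt j H (opAt i (fun _ => q) f) =
      -opAt j H (opAt j (fun _ => q) f) := by
    have h1 : ∑ i ∈ Finset.univ.erase p, opAt j H (opAt i (fun _ => q) f) = 0 := by
      have h2 : opAt j H (diffOn q (Finset.univ.erase p) f) =
          ∑ i ∈ Finset.univ.erase p, opAt j H (opAt i (fun _ => q) f) := by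
        funext v
        simp only [diffOn, Finset.sum_apply]
        unfold opAt
        rw [← Finset.mul_sum, ← Summable.tsum_finsetSum fun i hi => ?_]
        · simp only [Finset.sum_apply, Finset.mul_sum]
        · exact DecaysAt.summable_kernel hj hk
            (hfM.opAt (k := fun _ => q) (Finset.ne_of_mem_erase hi) le_rfl hq) v (v j)
      rw [← h2, hclosed]
      funext v
      simp [opAt]
    rw [← Finset.add_sum_erase _ _ hjT] at h1
    exact eq_neg_of_add_eq_zero_right h1
  -- The division is a contracting homotopy for the differential of the `j`-th factor and
  -- anticommutes with the others.
  have hmain : ∀ v, diffOn q (Finset.univ.erase p) (opAt j H f) v =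
      opAt j (fun _ => q) (opAt j H f) v + if (v j).isHigh s then f v else 0 := by
    intro v
    rw [diffOn, ← Finset.add_sum_erase _ _ hjT, Finset.sum_congr rfl hanti,
      Finset.sum_neg_distrib, hHsum, neg_neg, Pi.add_apply,
      opAt_division_koszul hK hL ht htD htM hh hinv hDb hj hfM]
  have hhigh : ∀ v, (v j).isHigh s → opAt j (fun _ => q) (opAt j H f) v = 0 := by
    intro v hv
    have : ∀ y, q y (v j) = 0 := fun y => koszulKernel_of_not_isLow (by
      rw [not_isLow_of_isHigh hv]; exact Bool.false_ne_true)
    rw [opAt]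
    simp [this]
  refine ⟨opAt j H f, hg, fun v hv => ?_, fun i hij hfi v hv => ?_⟩
  · rw [hmain, hhigh v hv, if_pos hv, zero_add]
  · have h0 : opAt j (fun _ => q) (opAt j H f) v = 0 := by
      have : ∀ z, f (Function.update v j z) = 0 := fun z =>
        hfi _ (by rwa [Function.update_of_ne hij])
      unfold opAt
      simp [this]
    rw [hmain, h0, hfi v hv]
    simp

/-- The differential on all factors except the `p`-th one is exact on monomials with a high factor
other than the `p`-th one: the distances from the `p`-th factor are independent, so each
division by the difference operator can be carried out separately. -/
theorem exists_primitive_erase {D : ℤ → ℂ} (hD : IsDifferenceOperator D) (s : Chirality)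
    {p : Fin d} {f : (Fin d → Letter N) → ℂ} (hf : IsLocalAt p f)
    (hclosed : diffOn (koszulKernel D s) (Finset.univ.erase p) f = 0) :
    ∃ g, IsLocalAt p g ∧ ∀ v, ∀ i ≠ p, (v i).isHigh s →
      diffOn (koszulKernel D s) (Finset.univ.erase p) g v = f v := by
  have key : ∀ J : Finset (Fin d), J ⊆ Finset.univ.erase p → ∀ f : (Fin d → Letter N) → ℂ,
      IsLocalAt p f → diffOn (koszulKernel D s) (Finset.univ.erase p) f = 0 →
      (∀ i ≠ p, i ∉ J → ∀ v, (v i).isHigh s → f v = 0) →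
      ∃ g, IsLocalAt p g ∧ ∀ v, ∀ i ≠ p, (v i).isHigh s →
        diffOn (koszulKernel D s) (Finset.univ.erase p) g v = f v := by
    have hq := isDifferentialKernel_koszulKernel (N := N) hD s
    intro J
    induction J using Finset.induction_on with
    | empty =>
      intro _ f _ _ h0
      refine ⟨0, IsLocalAt.zero, fun v i hi hv => ?_⟩
      rw [h0 i hi (Finset.notMem_empty _) v hv]
      simp [diffOn, opAt]
    | insert j J hjJ ih =>
      intro hJ f hf hclosed h0
      have hj : j ≠ p := Finset.ne_of_mem_erase (hJ (Finset.mem_insert_self _ _))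
      obtain ⟨g, hg, hg1, hg2⟩ := exists_primitive_step hD s hj hf hclosed
      have hdg := hg.diffOn_koszulKernel hD s
      obtain ⟨g', hg', hg3⟩ := ih ((Finset.subset_insert _ _).trans hJ)
        (diffOn (koszulKernel D s) (Finset.univ.erase p) g - f) (hdg.sub hf)
        (by rw [hq.diffOn_sub hdg.isBoundedCoeff hf.isBoundedCoeff,
          hq.diffOn_diffOn hg.isBoundedCoeff, hclosed, sub_zero])
        (fun i hi hiJ v hv => by
          rw [Pi.sub_apply]
          by_cases hij : i = j
          · subst hij
            rw [hg1 v hv, sub_self]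
          · have := h0 i hi (by simp [hij, hiJ])
            rw [hg2 i hij this v hv, this v hv, sub_zero])
      refine ⟨g - g', hg.sub hg', fun v i hi hv => ?_⟩
      rw [hq.diffOn_sub hg.isBoundedCoeff hg'.isBoundedCoeff, Pi.sub_apply, hg3 v i hi hv,
        Pi.sub_apply, sub_sub_cancel]
  exact key _ subset_rfl f hf hclosed fun i hi hi' =>
    absurd (Finset.mem_erase.mpr ⟨hi, Finset.mem_univ _⟩) hi'

/-- The number of high factors with index in `T`. -/
def highCount (s : Chirality) (T : Finset (Fin d)) (v : Fin d → Letter N) : ℕ :=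
  (T.filter fun i => (v i).isHigh s).card

theorem highCount_update {s : Chirality} {T : Finset (Fin d)} {v : Fin d → Letter N} {i : Fin d}
    (hi : i ∈ T) {y : Letter N} (hy : y.isHigh s) (hx : (v i).isHigh s = false) :
    highCount s T (Function.update v i y) = highCount s T v + 1 := by
  unfold highCount
  have : T.filter (fun j => (Function.update v i y j).isHigh s) =
      insert i (T.filter fun j => (v j).isHigh s) := by
    ext j
    by_cases hj : j = i
    · subst hj; simp [hi, hy]
    · simp [hj]
  rw [this, Finset.card_insert_of_notMem (by simp [hx])]

theorem highCount_update_of_notMem {s : Chirality} {T : Finset (Fin d)} {v : Fin d → Letter N}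
    {i : Fin d} (hi : i ∉ T) (y : Letter N) :
    highCount s T (Function.update v i y) = highCount s T v := by
  unfold highCount
  congr 1
  refine Finset.filter_congr fun j hj => ?_
  have hji : j ≠ i := fun h => hi (h ▸ hj)
  rw [Function.update_of_ne hji]

theorem isHigh_shift (s : Chirality) (a : ℤ) (x : Letter N) :
    (x.shift a).isHigh s = x.isHigh s := by
  cases x <;> rfl

theorem highCount_shift (s : Chirality) (T : Finset (Fin d)) (a : ℤ) (v : Fin d → Letter N) :
    highCount s T (fun i => (v i).shift a) = highCount s T v := by
  simp only [highCount, isHigh_shift]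

theorem exists_isHigh_of_highCount_pos {s : Chirality} {T : Finset (Fin d)} {v : Fin d → Letter N}
    (h : 0 < highCount s T v) : ∃ i ∈ T, (v i).isHigh s := by
  obtain ⟨i, hi⟩ := Finset.card_pos.mp h
  exact ⟨i, (Finset.mem_filter.mp hi).1, (Finset.mem_filter.mp hi).2⟩

theorem highCount_univ (s : Chirality) (p : Fin d) (v : Fin d → Letter N) :
    highCount s Finset.univ v =
      highCount s (Finset.univ.erase p) v + if (v p).isHigh s then 1 else 0 := by
  unfold highCount
  rw [← Finset.insert_erase (Finset.mem_univ p), Finset.filter_insert]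
  split_ifs with h
  · rw [Finset.card_insert_of_notMem (by simp)]
    simp
  · simp

/-- Exactness of the differential on the factors other than the `p`-th one, with the condition `b`
on the `p`-th factor kept. -/
theorem exists_primitive_erase_of_support {D : ℤ → ℂ} (hD : IsDifferenceOperator D)
    (s : Chirality) {p : Fin d} {f : (Fin d → Letter N) → ℂ} (hf : IsLocalAt p f)
    (hclosed : diffOn (koszulKernel D s) (Finset.univ.erase p) f = 0) (b : Bool)
    (hb : ∀ v, f v ≠ 0 → (v p).isHigh s = b)
    (hc : ∀ v, f v ≠ 0 → 1 ≤ highCount s (Finset.univ.erase p) v) :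
    ∃ g, IsLocalAt p g ∧ diffOn (koszulKernel D s) (Finset.univ.erase p) g = f ∧
      ∀ v, g v ≠ 0 → (v p).isHigh s = b ∧ 2 ≤ highCount s (Finset.univ.erase p) v := by
  obtain ⟨g, hg, hgf⟩ := exists_primitive_erase hD s hf hclosed
  classical
  set c : ℕ → (Fin d → Letter N) → ℂ := fun k v =>
    if (v p).isHigh s = b ∧ k ≤ highCount s (Finset.univ.erase p) v then 1 else 0 with hcdef
  refine ⟨fun v => c 2 v * g v, hg.weight (fun a v => ?_) (fun v => ?_), ?_, fun v hv => ?_⟩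
  · simp only [hcdef, isHigh_shift, highCount_shift]
  · simp only [hcdef]; split_ifs <;> simp
  · rw [diffOn_weight (c := c 2) (c' := c 1)]
    · funext v
      simp only [hcdef]
      split_ifs with h
      · obtain ⟨i, hi, hhi⟩ := exists_isHigh_of_highCount_pos h.2
        rw [one_mul, hgf v i (Finset.ne_of_mem_erase hi) hhi]
      · rw [zero_mul]
        by_contra hne
        exact h ⟨hb v (Ne.symm hne), hc v (Ne.symm hne)⟩
    · intro v i hi y hy
      simp only [hcdef, Function.update_of_ne (Finset.ne_of_mem_erase hi).symm,
        highCount_update hi (isHigh_of_koszulKernel_ne_zero hy)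
          (not_isHigh_of_isLow (koszulKernel_ne_zero hy).1)]
      simp
  · by_contra hn
    exact hv (by simp only [hcdef, if_neg hn, zero_mul])

/-- The Koszul complex, with the site of a reference factor as origin, is exact on coefficients of
monomials with at least two high factors.  The differential of the reference factor is not
independent of the others; it is dealt with by solving first on monomials whose reference factor is
high and then on the rest. -/
theorem exists_primitive_univ {D : ℤ → ℂ} (hD : IsDifferenceOperator D) (s : Chirality)
    {p : Fin d} {f : (Fin d → Letter N) → ℂ} (hf : IsLocalAt p f)
    (hclosed : diffOn (koszulKernel D s) Finset.univ f = 0)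
    (hc : ∀ v, f v ≠ 0 → 2 ≤ highCount s Finset.univ v) :
    ∃ g, IsLocalAt p g ∧ diffOn (koszulKernel D s) Finset.univ g = f := by
  have hq := isDifferentialKernel_koszulKernel (N := N) hD s
  set q := koszulKernel (N := N) D s with hqdef
  have hsplit : ∀ (g : (Fin d → Letter N) → ℂ) v, diffOn q Finset.univ g v =
      opAt p (fun _ => q) g v + diffOn q (Finset.univ.erase p) g v := by
    intro g v
    rw [diffOn, ← Finset.add_sum_erase _ _ (Finset.mem_univ p)]; rfl
  have hpzero : ∀ (g : (Fin d → Letter N) → ℂ) v, (v p).isHigh s →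
      opAt p (fun _ => q) g v = 0 := by
    intro g v hv
    have : ∀ y, q y (v p) = 0 := fun y => koszulKernel_of_not_isLow (by
      rw [not_isLow_of_isHigh hv]; exact Bool.false_ne_true)
    rw [opAt]
    simp [this]
  have hplow : ∀ g : (Fin d → Letter N) → ℂ, (∀ v, g v ≠ 0 → (v p).isHigh s = false) →
      opAt p (fun _ => q) g = 0 := by
    intro g hg
    funext v
    have : ∀ y, q y (v p) * g (Function.update v p y) = 0 := by
      intro y
      by_contra hne
      have h1 := hg _ (right_ne_zero_of_mul hne)
      rw [Function.update_self, isHigh_of_koszulKernel_ne_zero (left_ne_zero_of_mul hne)] at h1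
      exact Bool.noConfusion h1
    simp [opAt, this]
  set x : (Fin d → Letter N) → ℂ := fun v => (if (v p).isHigh s then 1 else 0) * f v with hx
  have hxloc : IsLocalAt p x := hf.weight (fun a v => by rw [isHigh_shift])
    (fun v => by split_ifs <;> simp)
  have hxclosed : diffOn q (Finset.univ.erase p) x = 0 := by
    rw [hx, diffOn_weight (c := fun v => if (v p).isHigh s then (1 : ℂ) else 0)
      (c' := fun v => if (v p).isHigh s then (1 : ℂ) else 0)
      (fun v i hi y _ => by simp only [Function.update_of_ne (Finset.ne_of_mem_erase hi).symm])]
    funext v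
    by_cases hv : (v p).isHigh s
    · have := congrFun hclosed v
      rw [hsplit, hpzero f v hv, zero_add] at this
      simp [this]
    · simp [hv]
  have hxhigh : ∀ v, x v ≠ 0 → (v p).isHigh s = true := fun v hv => by
    by_contra h
    exact hv (by simp [hx, h])
  obtain ⟨y, hy, hyx, hysupp⟩ := exists_primitive_erase_of_support hD s hxloc hxclosed true hxhigh
    (fun v hv => by
      have h1 := hc v (right_ne_zero_of_mul hv)
      rw [highCount_univ s p, if_pos (hxhigh v hv)] at h1
      omega)
  -- In the remainder the reference factor is low, so that its differential only involves the
  -- other factors.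
  set z := diffOn q Finset.univ y - f with hz
  have hdy : diffOn q Finset.univ y = opAt p (fun _ => q) y + x := by
    funext v
    rw [hsplit, hyx]; rfl
  have hdyloc : IsLocalAt p (diffOn q Finset.univ y) := by
    rw [hdy]
    have := (hy.opAt_koszulKernel_self hD s).sub (IsLocalAt.zero.sub hxloc)
    simpa using this
  have hzloc : IsLocalAt p z := hdyloc.sub hf
  have hzhigh : ∀ v, (v p).isHigh s → z v = 0 := by
    intro v hv
    rw [hz, hdy, Pi.sub_apply, Pi.add_apply, hpzero y v hv]
    simp [hx, hv]
  have hzlow : ∀ v, z v ≠ 0 → (v p).isHigh s = false := by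
    intro v hv
    by_contra h
    exact hv (hzhigh v (by simpa using h))
  have hzclosed : diffOn q (Finset.univ.erase p) z = 0 := by
    have h1 : diffOn q Finset.univ z = 0 := by
      rw [hz, hq.diffOn_sub hdyloc.isBoundedCoeff hf.isBoundedCoeff,
        hq.diffOn_diffOn hy.isBoundedCoeff, hclosed, sub_zero]
    funext v
    have := congrFun h1 v
    rwa [hsplit, hplow z hzlow, Pi.zero_apply, zero_add] at this
  obtain ⟨w, hw, hwz, hwsupp⟩ := exists_primitive_erase_of_support hD s hzloc hzclosed false hzlow
    (fun v hv => by
      have hlow := hzlow v hv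
      by_cases hfv : f v = 0
      · have h1 : opAt p (fun _ => q) y v ≠ 0 := by
          intro h0
          refine hv ?_
          rw [hz, hdy, Pi.sub_apply, Pi.add_apply, h0]
          simp [hx, hfv]
        by_contra hcount
        refine h1 ?_
        have : ∀ u, y (Function.update v p u) = 0 := by
          intro u
          by_contra hne
          have h2 := (hysupp _ hne).2
          rw [highCount_update_of_notMem (by simp)] at h2
          omega
        simp [opAt, this]
      · have h1 := hc v hfv
        rw [highCount_univ s p, hlow] at h1
        simp only [Bool.false_eq_true, if_false] at h1
        omega)
  refine ⟨y - w, hy.sub hw, ?_⟩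
  have hdw : diffOn q Finset.univ w = z := by
    funext v
    rw [hsplit, hplow w fun v hv => (hwsupp v hv).1, hwz, Pi.zero_apply, zero_add]
  rw [hq.diffOn_sub hy.isBoundedCoeff hw.isBoundedCoeff, hdw, hz, sub_sub_cancel]

/-! ### Supersymmetrization -/

theorem swapSign_comm (x y : Letter N) : swapSign x y = swapSign y x := by
  simp only [swapSign, Bool.and_comm]

theorem swapSign_mul_self (x y : Letter N) : swapSign x y * swapSign x y = 1 := by
  unfold swapSign; split_ifs <;> norm_num

theorem swapSign_of_parity {x y : Letter N} (h : y.parity = -x.parity) (z : Letter N) :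
    swapSign y z = swapSign x z * z.parity := by
  unfold parity at h ⊢
  unfold swapSign
  cases hx : x.isOdd <;> cases hy : y.isOdd <;> rw [hx, hy] at h <;> norm_num at h <;>
    cases z.isOdd <;> norm_num

/-- The sign of `koszulSign`, for monomials given as functions on `Fin d`. -/
noncomputable def permSign (v : Fin d → Letter N) (σ : Equiv.Perm (Fin d)) : ℂ :=
  ∏ i : Fin d, ∏ j : Fin d, if i < j ∧ σ j < σ i then swapSign (v (σ i)) (v (σ j)) else 1

theorem prod_pairs_comp_perm (F : Fin d → Fin d → ℂ) (hF : ∀ i j, F i j = F j i)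
    (τ : Equiv.Perm (Fin d)) :
    ∏ i, ∏ j, (if i < j then F (τ i) (τ j) else 1) = ∏ i, ∏ j, if i < j then F i j else 1 := by
  rw [← Finset.prod_product', ← Finset.prod_product', ← Finset.prod_filter, ← Finset.prod_filter]
  refine Finset.prod_bij' (fun p _ => if τ p.1 < τ p.2 then (τ p.1, τ p.2) else (τ p.2, τ p.1))
    (fun p _ => if τ.symm p.1 < τ.symm p.2 then (τ.symm p.1, τ.symm p.2)
      else (τ.symm p.2, τ.symm p.1)) ?_ ?_ ?_ ?_ ?_
  · rintro ⟨i, j⟩ h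
    simp only [Finset.mem_filter, Finset.mem_product, Finset.mem_univ, true_and] at h ⊢
    have : τ i ≠ τ j := fun e => h.ne (τ.injective e)
    split_ifs with h1
    · exact h1
    · exact lt_of_le_of_ne (not_lt.mp h1) this.symm
  · rintro ⟨i, j⟩ h
    simp only [Finset.mem_filter, Finset.mem_product, Finset.mem_univ, true_and] at h ⊢
    have : τ.symm i ≠ τ.symm j := fun e => h.ne (τ.symm.injective e)
    split_ifs with h1
    · exact h1
    · exact lt_of_le_of_ne (not_lt.mp h1) this.symm
  · rintro ⟨i, j⟩ h
    simp only [Finset.mem_filter, Finset.mem_product, Finset.mem_univ, true_and] at h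
    by_cases h1 : τ i < τ j
    · simp [h1, h]
    · simp [h1, h.not_gt]
  · rintro ⟨i, j⟩ h
    simp only [Finset.mem_filter, Finset.mem_product, Finset.mem_univ, true_and] at h
    by_cases h1 : τ.symm i < τ.symm j
    · simp [h1, h]
    · simp [h1, h.not_gt]
  · rintro ⟨i, j⟩ h
    by_cases h1 : τ i < τ j
    · simp [h1]
    · simp [h1, hF (τ i)]

theorem permSign_mul (v : Fin d → Letter N) (σ τ : Equiv.Perm (Fin d)) :
    permSign v (σ * τ) = permSign v σ * permSign (v ∘ σ) τ := by
  set F : Fin d → Fin d → ℂ := fun a b =>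
    if (a < b ∧ σ b < σ a) ∨ (b < a ∧ σ a < σ b) then swapSign (v (σ a)) (v (σ b)) else 1 with hF
  have h1 : permSign v σ = ∏ i, ∏ j, if i < j then F i j else 1 := by
    unfold permSign
    refine Finset.prod_congr rfl fun i _ => Finset.prod_congr rfl fun j _ => ?_
    by_cases h : i < j
    · simp [hF, h, h.not_gt]
    · simp [h]
  rw [h1, ← prod_pairs_comp_perm F (fun i j => by
    simp only [hF, swapSign_comm (v (σ i))]
    congr 1
    exact propext or_comm) τ]
  unfold permSign
  rw [← Finset.prod_mul_distrib]
  refine Finset.prod_congr rfl fun i _ => ?_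
  rw [← Finset.prod_mul_distrib]
  refine Finset.prod_congr rfl fun j _ => ?_
  by_cases h : i < j
  · have h2 : τ i ≠ τ j := fun e => h.ne (τ.injective e)
    have h3 : σ (τ i) ≠ σ (τ j) := fun e => h2 (σ.injective e)
    rcases lt_or_gt_of_ne h2 with h4 | h4 <;> rcases lt_or_gt_of_ne h3 with h5 | h5 <;>
      simp [hF, h, h4, h5, h4.not_gt, h5.not_gt, swapSign_mul_self]
  · simp [h]

theorem permSign_one (v : Fin d → Letter N) : permSign v 1 = 1 := by
  unfold permSign
  refine Finset.prod_eq_one fun i _ => Finset.prod_eq_one fun j _ => if_neg ?_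
  rintro ⟨h1, h2⟩
  exact h1.not_gt h2

theorem norm_permSign (v : Fin d → Letter N) (σ : Equiv.Perm (Fin d)) : ‖permSign v σ‖ = 1 := by
  unfold permSign
  rw [norm_prod]
  refine Finset.prod_eq_one fun i _ => ?_
  rw [norm_prod]
  refine Finset.prod_eq_one fun j _ => ?_
  unfold swapSign
  split_ifs <;> simp

theorem permSign_shift (a : ℤ) (v : Fin d → Letter N) (σ : Equiv.Perm (Fin d)) :
    permSign (fun i => (v i).shift a) σ = permSign v σ := by
  have : ∀ x y : Letter N, swapSign (x.shift a) (y.shift a) = swapSign x y := by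
    intro x y
    cases x <;> cases y <;> rfl
  simp only [permSign, this]

theorem permSign_update (v : Fin d → Letter N) (σ : Equiv.Perm (Fin d)) (j : Fin d) {y : Letter N}
    (hy : y.parity = -(v (σ j)).parity) :
    permSign (Function.update v (σ j) y) σ = permSign v σ *
      ∏ k, if (k < j ∧ σ j < σ k) ∨ (j < k ∧ σ k < σ j) then (v (σ k)).parity else 1 := by
  have h1 : ∏ k, (if (k < j ∧ σ j < σ k) ∨ (j < k ∧ σ k < σ j) then (v (σ k)).parity else 1) =
      (∏ k, if k < j ∧ σ j < σ k then (v (σ k)).parity else 1) *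
      ∏ k, if j < k ∧ σ k < σ j then (v (σ k)).parity else 1 := by
    rw [← Finset.prod_mul_distrib]
    refine Finset.prod_congr rfl fun k _ => ?_
    by_cases h2 : k < j
    · simp [h2, h2.not_gt]
    · simp [h2]
  have h2 : (∏ k, if k < j ∧ σ j < σ k then (v (σ k)).parity else 1) = ∏ k, ∏ l,
      if l = j then (if k < j ∧ σ j < σ k then (v (σ k)).parity else 1) else 1 := by
    simp
  have h3 : (∏ k, if j < k ∧ σ k < σ j then (v (σ k)).parity else 1) = ∏ k, ∏ l,
      if k = j then (if j < l ∧ σ l < σ j then (v (σ l)).parity else 1) else 1 := by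
    rw [Finset.prod_comm]; simp
  rw [h1, h2, h3]
  unfold permSign
  rw [← Finset.prod_mul_distrib, ← Finset.prod_mul_distrib]
  refine Finset.prod_congr rfl fun k _ => ?_
  rw [← Finset.prod_mul_distrib, ← Finset.prod_mul_distrib]
  refine Finset.prod_congr rfl fun l _ => ?_
  by_cases hk : k = j
  · subst hk
    by_cases hl : l = k
    · subst hl; simp
    · have : σ l ≠ σ k := fun e => hl (σ.injective e)
      simp only [Function.update_self, Function.update_of_ne this, hl, if_false, if_true]
      split_ifs
      · rw [swapSign_of_parity hy, one_mul]
      · simp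
  · have hk' : σ k ≠ σ j := fun e => hk (σ.injective e)
    by_cases hl : l = j
    · subst hl
      simp only [Function.update_self, Function.update_of_ne hk', hk, if_false, if_true]
      split_ifs
      · rw [swapSign_comm, swapSign_of_parity hy, swapSign_comm, mul_one]
      · simp
    · have hl' : σ l ≠ σ j := fun e => hl (σ.injective e)
      simp only [Function.update_of_ne hk', Function.update_of_ne hl', hk, hl, if_false, mul_one]

theorem leftSign_eq_prod (v : Fin d → Letter N) (i : Fin d) :
    leftSign v i = ∏ k, if k < i then (v k).parity else 1 := by
  unfold leftSign
  rw [← Finset.prod_filter]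
  congr 1
  ext k; simp

theorem leftSign_mul_permSign_update (v : Fin d → Letter N) (σ : Equiv.Perm (Fin d)) (j : Fin d)
    {y : Letter N} (hy : y.parity = -(v (σ j)).parity) :
    leftSign v (σ j) * permSign (Function.update v (σ j) y) σ =
      permSign v σ * leftSign (v ∘ σ) j := by
  rw [permSign_update v σ j hy, leftSign_eq_prod, leftSign_eq_prod, ← Equiv.prod_comp σ,
    mul_left_comm, ← Finset.prod_mul_distrib]
  congr 1
  refine Finset.prod_congr rfl fun k _ => ?_
  by_cases hk : k = j
  · subst hk; simp
  · have h3 : σ k ≠ σ j := fun e => hk (σ.injective e)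
    rcases lt_or_gt_of_ne hk with h4 | h4 <;> rcases lt_or_gt_of_ne h3 with h5 | h5 <;>
      simp [h4, h5, h4.not_gt, h5.not_gt, parity_mul_self]

/-- The action of a permutation of the factors, with the sign that reordering the factors of the
monomials produces. -/
noncomputable def permute (σ : Equiv.Perm (Fin d)) (f : (Fin d → Letter N) → ℂ) :
    (Fin d → Letter N) → ℂ := fun v => permSign v σ * f (v ∘ σ)

theorem permute_mul (σ τ : Equiv.Perm (Fin d)) (f : (Fin d → Letter N) → ℂ) :
    permute (σ * τ) f = permute σ (permute τ f) := by
  funext v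
  simp only [permute, permSign_mul, mul_assoc]
  rfl

theorem permute_one (f : (Fin d → Letter N) → ℂ) : permute 1 f = f := by
  funext v
  simp [permute, permSign_one]

/-- The differential commutes with permutations of the factors. -/
theorem permute_diffOn {q : Letter N → Letter N → ℂ} (hq : IsOddKernel q)
    (σ : Equiv.Perm (Fin d)) (f : (Fin d → Letter N) → ℂ) :
    permute σ (diffOn q Finset.univ f) = diffOn q Finset.univ (permute σ f) := by
  funext v
  rw [permute]
  simp only [diffOn, Finset.sum_apply]
  rw [← Equiv.sum_comp σ (fun i => opAt i (fun _ => q) (permute σ f) v), Finset.mul_sum]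
  refine Finset.sum_congr rfl fun j _ => ?_
  unfold opAt permute
  rw [← mul_assoc, ← tsum_mul_left, ← tsum_mul_left]
  refine tsum_congr fun y => ?_
  by_cases hy : q y (v (σ j)) = 0
  · simp [hy]
  · have e : (Function.update v (σ j) y) ∘ σ = Function.update (v ∘ σ) j y := by
      funext k
      by_cases hk : k = j
      · subst hk; simp
      · have : σ k ≠ σ j := fun e => hk (σ.injective e)
        simp [Function.update_of_ne this, Function.update_of_ne hk]
    rw [e, ← leftSign_mul_permSign_update v σ j (hq _ _ hy), Function.comp_apply]
    ring

/-- The projection onto supersymmetric coefficients. -/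
noncomputable def symmetrize (f : (Fin d → Letter N) → ℂ) : (Fin d → Letter N) → ℂ := fun v =>
  ((d.factorial : ℂ))⁻¹ * ∑ σ : Equiv.Perm (Fin d), permute σ f v

theorem permute_symmetrize (τ : Equiv.Perm (Fin d)) (f : (Fin d → Letter N) → ℂ) :
    permute τ (symmetrize f) = symmetrize f := by
  funext v
  rw [permute, symmetrize, symmetrize,
    ← Equiv.sum_comp (Equiv.mulLeft τ) (fun σ => permute σ f v)]
  simp only [Equiv.coe_mulLeft, permute_mul]
  rw [mul_left_comm, Finset.mul_sum]
  rfl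

theorem symmetrize_of_permute {f : (Fin d → Letter N) → ℂ} (hf : ∀ σ, permute σ f = f) :
    symmetrize f = f := by
  funext v
  simp only [symmetrize, hf, Finset.sum_const, Finset.card_univ, Fintype.card_perm,
    Fintype.card_fin, nsmul_eq_mul]
  rw [inv_mul_cancel_left₀]
  exact_mod_cast d.factorial_ne_zero

theorem IsBoundedCoeff.permute {f : (Fin d → Letter N) → ℂ} (hf : IsBoundedCoeff f)
    (σ : Equiv.Perm (Fin d)) : IsBoundedCoeff (permute σ f) := by
  obtain ⟨B, hB⟩ := hf
  refine ⟨B, fun v => ?_⟩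
  rw [LatticeSUSY.permute, norm_mul, norm_permSign, one_mul]
  exact hB _

theorem symmetrize_diffOn {q : Letter N → Letter N → ℂ} (hq : IsDifferentialKernel q)
    {f : (Fin d → Letter N) → ℂ} (hf : IsBoundedCoeff f) :
    diffOn q Finset.univ (symmetrize f) = symmetrize (diffOn q Finset.univ f) := by
  have h1 : symmetrize f = fun v => ((d.factorial : ℂ))⁻¹ *
      (∑ σ : Equiv.Perm (Fin d), permute σ f) v := by
    funext v
    simp [symmetrize]
  rw [h1, diffOn_weight (c := fun _ => ((d.factorial : ℂ))⁻¹)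
    (c' := fun _ => ((d.factorial : ℂ))⁻¹) (fun _ _ _ _ _ => rfl),
    hq.diffOn_sum _ fun σ _ => hf.permute σ]
  funext v
  simp [symmetrize, permute_diffOn hq.odd]

/-- An adjacent transposition contributes the sign of exchanging two neighbouring factors. -/
theorem permSign_swap (v : Fin d → Letter N) {i : ℕ} (hi : i + 1 < d) :
    permSign v (Equiv.swap ⟨i, i.lt_succ_self.trans hi⟩ ⟨i + 1, hi⟩) =
      swapSign (v ⟨i, i.lt_succ_self.trans hi⟩) (v ⟨i + 1, hi⟩) := by
  set a : Fin d := ⟨i, i.lt_succ_self.trans hi⟩ with ha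
  set b : Fin d := ⟨i + 1, hi⟩ with hb
  have hcond : ∀ k l : Fin d, k < l ∧ Equiv.swap a b l < Equiv.swap a b k → k = a ∧ l = b := by
    rintro ⟨k, hk⟩ ⟨l, hl⟩ ⟨h1, h2⟩
    simp only [Equiv.swap_apply_def, ha, hb, Fin.ext_iff] at h2 ⊢
    simp only [Fin.lt_def] at h1 h2
    split_ifs at h2 <;> simp_all <;> omega
  unfold permSign
  rw [Finset.prod_eq_single a, Finset.prod_eq_single b]
  · have h1 : a < b := by simp [ha, hb]
    simp [h1, swapSign_comm (v b)]
  · intro l _ hl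
    exact if_neg fun h => hl (hcond _ _ h).2
  · simp
  · intro k _ hk
    exact Finset.prod_eq_one fun l _ => if_neg fun h => hk (hcond _ _ h).1
  · simp

theorem ofFn_eq_append (v : Fin d → Letter N) {i : ℕ} (hi : i + 1 < d) :
    List.ofFn v = (List.ofFn v).take i ++ v ⟨i, i.lt_succ_self.trans hi⟩ :: v ⟨i + 1, hi⟩ ::
      (List.ofFn v).drop (i + 2) := by
  conv_lhs => rw [← List.take_append_drop i (List.ofFn v)]
  rw [List.drop_eq_getElem_cons (by simpa using by omega),
    List.drop_eq_getElem_cons (by simpa using by omega)]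
  simp

theorem ofFn_comp_swap (v : Fin d → Letter N) {i : ℕ} (hi : i + 1 < d) :
    List.ofFn (v ∘ Equiv.swap ⟨i, i.lt_succ_self.trans hi⟩ ⟨i + 1, hi⟩) =
      (List.ofFn v).take i ++ v ⟨i + 1, hi⟩ :: v ⟨i, i.lt_succ_self.trans hi⟩ ::
      (List.ofFn v).drop (i + 2) := by
  rw [ofFn_eq_append _ hi]
  congr 1
  · refine List.ext_getElem (by simp) fun k h1 h2 => ?_
    have hk : k < i := by simp at h1; omega
    simp only [List.getElem_take, List.getElem_ofFn, Function.comp]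
    rw [Equiv.swap_apply_of_ne_of_ne] <;> simp [Fin.ext_iff] <;> omega
  · simp only [Function.comp, Equiv.swap_apply_left, Equiv.swap_apply_right]
    congr 2
    refine List.ext_getElem (by simp) fun k h1 h2 => ?_
    simp only [List.getElem_drop, List.getElem_ofFn, Function.comp]
    rw [Equiv.swap_apply_of_ne_of_ne] <;> simp [Fin.ext_iff] <;> omega

/-- Supersymmetric coefficients are invariant under all signed permutations of the factors. -/
theorem IsSuperSymmetric.permute_ofFn {f : Coeffs N} (hf : IsSuperSymmetric f)
    (σ : Equiv.Perm (Fin d)) :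
    permute σ (fun v => f (List.ofFn v)) = fun v => f (List.ofFn v) := by
  obtain _ | n := d
  · rw [Subsingleton.elim σ 1, permute_one]
  · have hσ : σ ∈ Submonoid.closure
        (Set.range fun i : Fin n ↦ Equiv.swap i.castSucc i.succ) := by
      rw [Equiv.Perm.mclosure_swap_castSucc_succ]; trivial
    induction hσ using Submonoid.closure_induction with
    | mem σ h =>
      obtain ⟨i, rfl⟩ := h
      funext v
      have hi : (i : ℕ) + 1 < n + 1 := by omega
      have h1 := permSign_swap v hi
      have h2 := ofFn_comp_swap v hi
      have h3 := ofFn_eq_append v hi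
      have h4 := hf ((List.ofFn v).take i) ((List.ofFn v).drop (i + 2)) (v i.castSucc) (v i.succ)
      calc permSign v (Equiv.swap i.castSucc i.succ) *
            f (List.ofFn (v ∘ Equiv.swap i.castSucc i.succ)) =
            swapSign (v i.castSucc) (v i.succ) * f ((List.ofFn v).take i ++
              v i.succ :: v i.castSucc :: (List.ofFn v).drop (i + 2)) :=
          congrArg₂ _ h1 (congrArg f h2)
        _ = f ((List.ofFn v).take i ++
              v i.castSucc :: v i.succ :: (List.ofFn v).drop (i + 2)) := h4.symm
        _ = f (List.ofFn v) := (congrArg f h3).symm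
    | one => exact permute_one _
    | mul σ τ _ _ h1 h2 => rw [permute_mul, h2, h1]

theorem isSuperSymmetric_of_permute {f : Coeffs N}
    (hf : ∀ d, ∀ σ : Equiv.Perm (Fin d),
      permute σ (fun v => f (List.ofFn v)) = fun v => f (List.ofFn v)) : IsSuperSymmetric f := by
  intro u t x y
  set w := u ++ x :: y :: t with hw
  have hi : u.length + 1 < w.length := by simp [hw]
  have h1 := congrFun (hf w.length
    (Equiv.swap ⟨u.length, u.length.lt_succ_self.trans hi⟩ ⟨u.length + 1, hi⟩)) w.get
  simp only [permute] at h1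
  rw [permSign_swap, ofFn_comp_swap, List.ofFn_get] at h1
  rw [← h1]
  simp [hw]

/-! ### Exactness on local functionals of a fixed degree -/

/-- Exponential decay in every difference of two sites. -/
def IsPairLocal (f : (Fin d → Letter N) → ℂ) : Prop :=
  ∃ L M : ℝ, 0 < L ∧ 0 < M ∧ ∀ v, ∀ i j : Fin d, ∀ m n : ℤ, (v i).site = some m →
    (v j).site = some n → ‖f v‖ ≤ L * Real.exp (-M * |((m - n : ℤ) : ℝ)|)

theorem IsPairLocal.zero : IsPairLocal (0 : (Fin d → Letter N) → ℂ) :=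
  ⟨1, 1, one_pos, one_pos, fun v i j m n _ _ => by
    simp only [Pi.zero_apply, norm_zero]; positivity⟩

theorem IsPairLocal.add {f g : (Fin d → Letter N) → ℂ} (hf : IsPairLocal f)
    (hg : IsPairLocal g) : IsPairLocal (f + g) := by
  obtain ⟨L, M, hL, hM, hf⟩ := hf
  obtain ⟨L', M', hL', hM', hg⟩ := hg
  refine ⟨L + L', min M M', by positivity, lt_min hM hM', fun v i j m n hm hn => ?_⟩
  refine (norm_add_le _ _).trans ?_
  rw [add_mul]
  gcongr
  · refine (hf v i j m n hm hn).trans ?_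
    gcongr
    exact min_le_left _ _
  · refine (hg v i j m n hm hn).trans ?_
    gcongr
    exact min_le_right _ _

theorem IsPairLocal.sum {ι : Type*} (T : Finset ι) {f : ι → (Fin d → Letter N) → ℂ}
    (hf : ∀ i ∈ T, IsPairLocal (f i)) : IsPairLocal (∑ i ∈ T, f i) := by
  classical
  induction T using Finset.induction_on with
  | empty => exact IsPairLocal.zero
  | insert a T ha ih =>
    rw [Finset.sum_insert ha]
    exact (hf a (Finset.mem_insert_self _ _)).add
      (ih fun i hi => hf i (Finset.mem_insert_of_mem hi))

theorem IsPairLocal.weight {f : (Fin d → Letter N) → ℂ} (hf : IsPairLocal f)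
    {c : (Fin d → Letter N) → ℂ} (hc : ∀ v, ‖c v‖ ≤ 1) : IsPairLocal fun v => c v * f v := by
  obtain ⟨L, M, hL, hM, hf⟩ := hf
  refine ⟨L, M, hL, hM, fun v i j m n hm hn => ?_⟩
  rw [norm_mul]
  exact (mul_le_of_le_one_left (norm_nonneg _) (hc v)).trans (hf v i j m n hm hn)

theorem IsPairLocal.permute {f : (Fin d → Letter N) → ℂ} (hf : IsPairLocal f)
    (σ : Equiv.Perm (Fin d)) : IsPairLocal (permute σ f) := by
  obtain ⟨L, M, hL, hM, hf⟩ := hf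
  refine ⟨L, M, hL, hM, fun v i j m n hm hn => ?_⟩
  rw [LatticeSUSY.permute, norm_mul, norm_permSign, one_mul]
  exact hf (v ∘ σ) (σ.symm i) (σ.symm j) m n (by simpa using hm) (by simpa using hn)

theorem IsPairLocal.symmetrize {f : (Fin d → Letter N) → ℂ} (hf : IsPairLocal f) :
    IsPairLocal (symmetrize f) := by
  have h1 := (IsPairLocal.sum Finset.univ fun σ (_ : σ ∈ Finset.univ) => hf.permute σ).weight
    (c := fun _ => ((d.factorial : ℂ))⁻¹) (fun _ => by
      rw [norm_inv, Complex.norm_natCast]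
      exact inv_le_one_of_one_le₀ (by exact_mod_cast d.factorial_pos))
  convert h1 using 1
  funext v
  simp [LatticeSUSY.symmetrize]

theorem symmetrize_shift {f : (Fin d → Letter N) → ℂ}
    (hf : ∀ a v, f (fun i => (v i).shift a) = f v) (a : ℤ) (v : Fin d → Letter N) :
    symmetrize f (fun i => (v i).shift a) = symmetrize f v := by
  unfold symmetrize permute
  congr 1
  refine Finset.sum_congr rfl fun σ _ => ?_
  rw [permSign_shift]
  congr 1
  exact hf a (v ∘ σ)

theorem pos_of_site {x : Letter N} {n : ℤ} (h : x.site = some n) : x.pos = n := by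
  simp [pos, h]

theorem IsLocalAt.isPairLocal {p : Fin d} {f : (Fin d → Letter N) → ℂ} (hf : IsLocalAt p f) :
    IsPairLocal f := by
  obtain ⟨M, hM, L, hL, h⟩ := hf.decay
  refine ⟨L, M, hL, hM, fun v i j m n hm hn => (h v).trans ?_⟩
  have key : |((m - n : ℤ) : ℝ)| ≤ spread (v p).pos v := by
    by_cases hij : i = j
    · subst hij
      have : m = n := Option.some_injective _ (hm.symm.trans hn)
      simpa [this] using spread_nonneg _ _
    · have h1 : (v i).siteDist (v p).pos + (v j).siteDist (v p).pos ≤ spread (v p).pos v := by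
        unfold spread
        rw [← Finset.sum_pair (f := fun i => (v i).siteDist (v p).pos) hij]
        exact Finset.sum_le_sum_of_subset_of_nonneg (Finset.subset_univ _)
          fun _ _ _ => siteDist_nonneg _ _
      refine le_trans ?_ h1
      simp only [siteDist, hm, hn]
      have := abs_sub_le (m : ℝ) (v p).pos n
      rw [abs_sub_comm ((v p).pos : ℝ) n] at this
      push_cast; exact this
  gcongr ?_ * ?_
  exact Real.exp_le_exp.mpr (by nlinarith)

/-- The part of local coefficients in which the `p`-th factor has a site. -/
theorem IsPairLocal.isLocalAt {f : (Fin d → Letter N) → ℂ} (hf : IsPairLocal f)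
    (hs : ∀ a v, f (fun i => (v i).shift a) = f v) (p : Fin d) :
    IsLocalAt p fun v => (if (v p).site.isSome then 1 else 0) * f v := by
  obtain ⟨L, M, hL, hM, h⟩ := hf
  have hd : 0 < (d : ℝ) := by exact_mod_cast p.pos
  refine ⟨fun v hv => by simp [hv], fun a v => ?_, M / d, by positivity, L, hL, fun v => ?_⟩
  · rw [hs]
    have : ((v p).shift a).site.isSome = (v p).site.isSome := by cases v p <;> rfl
    rw [this]
  · beta_reduce
    by_cases hp : (v p).site.isSome
    · obtain ⟨a, ha⟩ := Option.isSome_iff_exists.mp hp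
      rw [if_pos hp, one_mul, pos_of_site ha]
      have h1 : ∀ i, ‖f v‖ ≤ L * Real.exp (-M * (v i).siteDist a) := by
        intro i
        unfold siteDist
        split
        · rename_i n hn
          exact h v i p n a hn ha
        · simpa using h v p p a a ha ha
      obtain ⟨i, -, hi⟩ := Finset.exists_max_image Finset.univ
        (fun i => (v i).siteDist a) ⟨p, Finset.mem_univ p⟩
      have h2 : spread a v ≤ d * (v i).siteDist a := by
        have := Finset.sum_le_card_nsmul Finset.univ (fun i => (v i).siteDist a) _ hi
        simpa [spread] using this
      refine (h1 i).trans ?_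
      gcongr ?_ * ?_
      refine Real.exp_le_exp.mpr ?_
      have h3 : M / d * spread a v ≤ M * (v i).siteDist a := by
        rw [div_mul_eq_mul_div, div_le_iff₀ hd]
        nlinarith
      linarith
    · rw [if_neg hp, zero_mul, norm_zero]
      positivity

/-- The number of factors that have a site. -/
def sitedCount (v : Fin d → Letter N) : ℕ :=
  (Finset.univ.filter fun i => (v i).site.isSome).card

theorem isSome_site_of_isLow {s : Chirality} {x : Letter N} (h : x.isLow s) : x.site.isSome := by
  cases x <;> simp_all [isLow, site]

theorem isSome_site_of_isHigh {s : Chirality} {x : Letter N} (h : x.isHigh s) :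
    x.site.isSome := by
  cases x <;> simp_all [isHigh, site]

theorem highCount_le_sitedCount (s : Chirality) (v : Fin d → Letter N) :
    highCount s Finset.univ v ≤ sitedCount v :=
  Finset.card_le_card fun i hi => by
    simp only [Finset.mem_filter, Finset.mem_univ, true_and] at hi ⊢
    exact isSome_site_of_isHigh hi

/-- A closed local functional with at least two high factors in each monomial is exact: a primitive
is found for each choice of reference factor, and the average of these primitives is symmetrized. -/
theorem exists_symmetric_primitive {D : ℤ → ℂ} (hD : IsDifferenceOperator D) (s : Chirality)
    {f : (Fin d → Letter N) → ℂ} (hperm : ∀ σ, permute σ f = f)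
    (hshift : ∀ a v, f (fun i => (v i).shift a) = f v) (hloc : IsPairLocal f)
    (hclosed : diffOn (koszulKernel D s) Finset.univ f = 0)
    (hc : ∀ v, f v ≠ 0 → 2 ≤ highCount s Finset.univ v) :
    ∃ g : (Fin d → Letter N) → ℂ, (∀ σ, permute σ g = g) ∧
      (∀ a v, g (fun i => (v i).shift a) = g v) ∧ IsPairLocal g ∧
      diffOn (koszulKernel D s) Finset.univ g = f := by
  have hq := isDifferentialKernel_koszulKernel (N := N) hD s
  have hex : ∀ p : Fin d, ∃ g, IsLocalAt p g ∧ diffOn (koszulKernel D s) Finset.univ g =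
      fun v => (if (v p).site.isSome then 1 else 0) * f v := by
    intro p
    refine exists_primitive_univ hD s (hloc.isLocalAt hshift p) ?_ fun v hv =>
      hc v (right_ne_zero_of_mul hv)
    rw [diffOn_weight (c := fun v => if (v p).site.isSome then (1 : ℂ) else 0)
      (c' := fun v => if (v p).site.isSome then (1 : ℂ) else 0), hclosed]
    · funext v; simp
    · intro v i _ y hy
      by_cases hi : i = p
      · subst hi
        simp only [Function.update_self, isSome_site_of_isLow (koszulKernel_ne_zero hy).1,
          isSome_site_of_isHigh (isHigh_of_koszulKernel_ne_zero hy)]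
      · simp only [Function.update_of_ne (Ne.symm hi)]
  choose g hg hgf using hex
  set c : (Fin d → Letter N) → ℂ := fun v => ((sitedCount v : ℂ))⁻¹ with hcdef
  set G : (Fin d → Letter N) → ℂ := fun v => c v * (∑ p, g p) v with hG
  have hgb : ∀ p ∈ Finset.univ, IsBoundedCoeff (g p) := fun p _ => (hg p).isBoundedCoeff
  have hc1 : ∀ v, ‖c v‖ ≤ 1 := by
    intro v
    simp only [hcdef, norm_inv, Complex.norm_natCast]
    exact Nat.cast_inv_le_one _
  have hGs : ∀ a v, G (fun i => (v i).shift a) = G v := by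
    intro a v
    have h1 : sitedCount (fun i => (v i).shift a) = sitedCount v := by
      have : ∀ x : Letter N, (x.shift a).site.isSome = x.site.isSome := fun x => by
        cases x <;> rfl
      simp only [sitedCount, this]
    simp only [hG, hcdef, h1, Finset.sum_apply, (hg _).shift]
  have hGl : IsPairLocal G :=
    (IsPairLocal.sum _ fun p _ => (hg p).isPairLocal).weight hc1
  have hGb : IsBoundedCoeff G := by
    obtain ⟨B, hB⟩ := IsBoundedCoeff.sum _ hgb
    refine ⟨B, fun v => ?_⟩
    rw [hG, norm_mul]
    exact (mul_le_of_le_one_left (norm_nonneg _) (hc1 v)).trans (hB v)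
  have hGd : diffOn (koszulKernel D s) Finset.univ G = f := by
    rw [hG, diffOn_weight (c := c) (c' := c), hq.diffOn_sum _ hgb]
    · funext v
      simp only [hgf, Finset.sum_apply, ← Finset.sum_mul, Finset.sum_boole]
      by_cases hv : f v = 0
      · simp [hv]
      · have h1 := (hc v hv).trans (highCount_le_sitedCount s v)
        have h2 : (sitedCount v : ℂ) ≠ 0 := by exact_mod_cast (by omega : sitedCount v ≠ 0)
        exact inv_mul_cancel_left₀ h2 _
    · intro v i _ y hy
      have h1 : ∀ j, (Function.update v i y j).site.isSome = (v j).site.isSome := by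
        intro j
        by_cases hj : j = i
        · subst hj
          rw [Function.update_self, isSome_site_of_isLow (koszulKernel_ne_zero hy).1,
            isSome_site_of_isHigh (isHigh_of_koszulKernel_ne_zero hy)]
        · rw [Function.update_of_ne hj]
      simp only [hcdef, sitedCount, h1]
  refine ⟨symmetrize G, fun σ => permute_symmetrize σ G, symmetrize_shift hGs, hGl.symmetrize, ?_⟩
  rw [symmetrize_diffOn hq hGb, hGd, symmetrize_of_permute hperm]

/-! ### Words and functions on `Fin d` -/

theorem leftSign_get (w : Word N) (i : Fin w.length) :
    leftSign w.get i = (-1 : ℂ) ^ ((w.take i).countP Letter.isOdd) := by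
  have h : ∀ l : Word N, (l.map parity).prod = (-1 : ℂ) ^ (l.countP Letter.isOdd) := by
    intro l
    induction l with
    | nil => simp
    | cons x l ih =>
      rw [List.map_cons, List.prod_cons, ih, List.countP_cons]
      unfold parity
      split_ifs <;> simp [pow_succ]
  rw [← h, List.map_take]
  have h2 : w.map parity = List.ofFn fun j => (w.get j).parity := by
    conv_lhs => rw [← List.ofFn_get w, List.map_ofFn]
    rfl
  rw [h2, List.prod_take_ofFn, leftSign]
  congr 1
  ext j
  rw [Finset.mem_Iio, Finset.mem_filter, Fin.lt_def]
  exact (and_iff_right (Finset.mem_univ _)).symm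

theorem set_eq_ofFn (w : Word N) (i : Fin w.length) (y : Letter N) :
    w.set i y = List.ofFn (Function.update w.get i y) := by
  refine List.ext_getElem (by simp) fun k h1 h2 => ?_
  rw [List.getElem_set, List.getElem_ofFn, Function.update_apply]
  simp [Fin.ext_iff, eq_comm]

/-- Lists of length `d` are the same as functions on `Fin d`. -/
theorem apply_ofFn {α β : Type*} (φ : ∀ d, (Fin d → β) → α) (v : Fin d → β) :
    φ (List.ofFn v).length (List.ofFn v).get = φ d v := by
  have key : ∀ (w : List β) (h : w.length = d), φ w.length w.get =
      φ d fun i => w.get (i.cast h.symm) := by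
    rintro w rfl; rfl
  rw [key _ (List.length_ofFn)]
  congr 1
  funext i
  simp

theorem derivation_get (q : Letter N → Letter N → ℂ) (f : Coeffs N) (w : Word N) :
    derivation true q f w = diffOn q Finset.univ (fun v => f (List.ofFn v)) w.get := by
  unfold derivation diffOn opAt
  rw [Finset.sum_apply]
  refine Finset.sum_congr rfl fun i _ => ?_
  rw [leftSign_get]
  simp only [if_true, set_eq_ofFn]

theorem derivation_ofFn (q : Letter N → Letter N → ℂ) (f : Coeffs N) (v : Fin d → Letter N) :
    derivation true q f (List.ofFn v) = diffOn q Finset.univ (fun v => f (List.ofFn v)) v := by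
  rw [derivation_get]
  exact apply_ofFn (fun d v => diffOn q Finset.univ (fun v : Fin d → Letter N => f (List.ofFn v)) v)
    v

theorem superchargeMatrix_eq_koszulKernel (D : ℤ → ℂ) {s : Chirality} {x y : Letter N}
    (hy : y.chirality = s) : superchargeMatrix D s.flip y x = koszulKernel D s y x := by
  subst hy
  rcases y with ⟨_ | _, n⟩ | ⟨_ | _, n⟩ | ⟨_ | _, n⟩ | ⟨_ | _, n⟩ | ⟨_ | _, n⟩ | ⟨_ | _, n⟩ <;>
    rcases x with ⟨_ | _, m⟩ | ⟨_ | _, m⟩ | ⟨_ | _, m⟩ | ⟨_ | _, m⟩ | ⟨_ | _, m⟩ | ⟨_ | _, m⟩ <;>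
    simp [superchargeMatrix, koszulKernel, Letter.chirality, Chirality.flip, isLow, raise, coef,
      pos, site]

/-- On functionals of type `s`, the supercharge of the opposite type is a Koszul differential. -/
theorem supercharge_ofFn (D : ℤ → ℂ) {s : Chirality} {f : Coeffs N}
    (hf : ∀ w, f w ≠ 0 → ∀ x ∈ w, x.chirality = s) (v : Fin d → Letter N) :
    supercharge D s.flip f (List.ofFn v) =
      diffOn (koszulKernel D s) Finset.univ (fun v => f (List.ofFn v)) v := by
  rw [supercharge, derivation_ofFn]
  simp only [diffOn, Finset.sum_apply, opAt]
  refine Finset.sum_congr rfl fun i _ => ?_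
  congr 1
  refine tsum_congr fun y => ?_
  by_cases h : f (List.ofFn (Function.update v i y)) = 0
  · rw [h, mul_zero, mul_zero]
  · rw [superchargeMatrix_eq_koszulKernel]
    refine hf _ h y ?_
    rw [List.mem_ofFn]
    exact ⟨i, Function.update_self ..⟩

theorem numberOp_apply (s : Chirality) (f : Coeffs N) (w : Word N) :
    numberOp s f w = (w.countP fun x => x.chirality = s) * f w := by
  unfold numberOp derivation
  have h1 : ∀ i : Fin w.length, ∑' y : Letter N,
      (if y = w.get i ∧ y.chirality = s then (1 : ℂ) else 0) * f (w.set i y) =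
      if (w.get i).chirality = s then f w else 0 := by
    intro i
    rw [tsum_eq_single (w.get i)]
    rotate_left
    · intro y hy
      rw [if_neg fun h => hy h.1, zero_mul]
    · simp
  simp only [h1, Bool.false_eq_true, if_false, one_mul]
  have h2 : ∀ l : Word N, (l.map fun x => if x.chirality = s then f w else 0).sum =
      (l.countP fun x => x.chirality = s) * f w := by
    intro l
    induction l with
    | nil => simp
    | cons x l ih =>
      rw [List.map_cons, List.sum_cons, ih, List.countP_cons]
      by_cases hx : x.chirality = s
      · simp [hx]; ring
      · simp [hx]
  rw [← h2 w]
  exact Fin.sum_univ_fun_getElem w fun x => if x.chirality = s then f w else 0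

/-! ### The terms with a single `χ` -/

theorem card_filter_eq_countP {α : Type*} (v : Fin d → α) (p : α → Bool) :
    (Finset.univ.filter fun i => p (v i)).card = (List.ofFn v).countP p := by
  induction d with
  | zero => simp
  | succ d ih =>
    rw [Finset.card_filter, Fin.sum_univ_succ, List.ofFn_succ, List.countP_cons, ← ih,
      Finset.card_filter, add_comm]

theorem exists_perm_of_ofFn_perm {α : Type*} [DecidableEq α] {v v' : Fin d → α}
    (h : (List.ofFn v).Perm (List.ofFn v')) : ∃ σ : Equiv.Perm (Fin d), v ∘ σ = v' := by
  have hcard : ∀ c, Fintype.card {i // v' i = c} = Fintype.card {i // v i = c} := by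
    intro c
    rw [Fintype.card_subtype, Fintype.card_subtype]
    have h1 := h.countP_eq (fun x => decide (x = c))
    rw [← card_filter_eq_countP, ← card_filter_eq_countP] at h1
    simpa using h1.symm
  refine ⟨Equiv.ofFiberEquiv fun c => Fintype.equivOfCardEq (hcard c), ?_⟩
  funext i
  exact Equiv.ofFiberEquiv_map _ i

theorem highCount_eq_countP (s : Chirality) (v : Fin d → Letter N) :
    highCount s Finset.univ v = (List.ofFn v).countP (Letter.isHigh s) :=
  card_filter_eq_countP v _

/-- With at most one fermionic factor, reordering the factors produces no sign. -/
theorem IsSuperSymmetric.eq_of_perm {f : Coeffs N} (hf : IsSuperSymmetric f) {w w' : Word N}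
    (h : w.Perm w') (hw : w.countP Letter.isOdd ≤ 1) : f w = f w' := by
  have key : ∀ u : Word N, f (u ++ w) = f (u ++ w') := by
    induction h with
    | nil => exact fun _ => rfl
    | cons x _ ih =>
      intro u
      rw [List.countP_cons] at hw
      have := ih (by omega) (u ++ [x])
      simpa using this
    | swap x y l =>
      intro u
      rw [hf u l y x, swapSign, if_neg, one_mul]
      intro hxy
      rw [Bool.and_eq_true] at hxy
      rw [List.countP_cons, List.countP_cons, if_pos hxy.1, if_pos hxy.2] at hw
      omega
    | trans h1 _ ih1 ih2 =>
      exact fun u => (ih1 hw u).trans (ih2 (h1.countP_eq _ ▸ hw) u)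
  exact key []

/-- The kind of a variable as far as `clrWord` is concerned: `0`, `1`, `2` for `ρ_s`, `χ_s`, `φ_s`,
and `3` for all others. -/
def Letter.kind (s : Chirality) : Letter N → ℕ
  | rho a _ => if a = s then 0 else 3
  | chi a _ => if a = s then 1 else 3
  | phi a _ => if a = s then 2 else 3
  | _ => 3

/-- The sequence of kinds `0 ⋯ 0 1 2 ⋯ 2` of a word `ρ ⋯ ρ χ φ ⋯ φ`. -/
def IsClrPattern (l : List ℕ) : Prop :=
  ∃ r k, l = List.replicate r 0 ++ 1 :: List.replicate k 2

theorem exists_eq_map_of_forall {α β : Type*} (g : α → β) {l : List β}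
    (h : ∀ y ∈ l, ∃ a, g a = y) : ∃ l' : List α, l = l'.map g := by
  have : l ∈ Set.range (List.map g) := by rw [Set.range_list_map]; exact h
  obtain ⟨l', hl'⟩ := this
  exact ⟨l', hl'.symm⟩

theorem isClrPattern_map_kind_iff {s : Chirality} {w : Word N} :
    IsClrPattern (w.map (kind s)) ↔ ∃ t, w = clrWord s t := by
  constructor
  · rintro ⟨r, k, h⟩
    obtain ⟨a, b, rfl, ha, hb⟩ := List.map_eq_append_iff.mp h
    obtain ⟨x, c, rfl, hx, hc⟩ := List.map_eq_cons_iff.mp hb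
    have ha' : ∃ is : List (Fin N), a = is.map (rho s) := by
      rw [List.eq_replicate_iff] at ha
      refine exists_eq_map_of_forall _ fun y hy => ?_
      have hk := ha.2 _ (List.mem_map_of_mem hy)
      clear ha hb hc hx hy h
      cases y <;> simp [kind] at hk ⊢ <;>
        first | exact hk.symm | split_ifs at hk
    have hc' : ∃ ns : List ℤ, c = ns.map (phi s) := by
      rw [List.eq_replicate_iff] at hc
      refine exists_eq_map_of_forall _ fun y hy => ?_
      have hk := hc.2 _ (List.mem_map_of_mem hy)
      clear ha hb hc hx hy h
      cases y <;> simp [kind] at hk ⊢ <;>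
        first | exact hk.symm | (split_ifs at hk <;> simp_all)
    obtain ⟨is, rfl⟩ := ha'
    obtain ⟨ns, rfl⟩ := hc'
    cases x with
    | chi b m =>
      by_cases hb : b = s
      · subst hb
        exact ⟨(is, m, ns), rfl⟩
      · simp [kind, hb] at hx
    | _ => simp [kind] at hx; try (split_ifs at hx <;> omega)
  · rintro ⟨⟨is, m, ns⟩, rfl⟩
    refine ⟨is.length, ns.length, ?_⟩
    simp [clrWord, kind, Function.comp_def, List.map_const']

open Classical in
/-- The number of orderings of the factors in which the kinds follow the pattern of `clrWord`. -/
noncomputable def clrCount (u : Fin d → ℕ) : ℕ :=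
  (Finset.univ.filter fun σ : Equiv.Perm (Fin d) => IsClrPattern (List.ofFn (u ∘ σ))).card

theorem clrCount_comp (u : Fin d → ℕ) (τ : Equiv.Perm (Fin d)) :
    clrCount (u ∘ τ) = clrCount u := by
  classical
  unfold clrCount
  refine Finset.card_bijective (fun σ => τ * σ) (Group.mulLeft_bijective τ) fun σ => ?_
  simp only [Finset.mem_filter, Finset.mem_univ, true_and]
  rfl

/-- The number of orderings of a word in which it becomes a `clrWord`. -/
noncomputable def clrOrderings (s : Chirality) (w : Word N) : ℕ :=
  clrCount fun i => (w.get i).kind s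

theorem clrOrderings_ofFn (s : Chirality) (v : Fin d → Letter N) :
    clrOrderings s (List.ofFn v) = clrCount fun i => (v i).kind s :=
  apply_ofFn (fun d (v : Fin d → Letter N) => clrCount fun i => (v i).kind s) v

theorem clrOrderings_congr {s : Chirality} {w w' : Word N}
    (h : w.map (kind s) = w'.map (kind s)) : clrOrderings s w = clrOrderings s w' := by
  have key : ∀ w : Word N, clrOrderings s w = clrCount (w.map (kind s)).get := by
    intro w
    have h1 := apply_ofFn (fun _ u => clrCount u) fun i => (w.get i).kind s
    have h2 : (List.ofFn fun i => (w.get i).kind s) = w.map (kind s) := by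
      conv_rhs => rw [← List.ofFn_get w, List.map_ofFn]
      rfl
    rw [h2] at h1
    exact h1.symm
  rw [key, key, h]

theorem clrOrderings_eq_card (s : Chirality) (w : Word N)
    [DecidablePred fun σ : Equiv.Perm (Fin w.length) =>
      ∃ t, List.ofFn (fun i => w.get (σ i)) = clrWord s t] :
    clrOrderings s w = (Finset.univ.filter fun σ : Equiv.Perm (Fin w.length) =>
      ∃ t, List.ofFn (fun i => w.get (σ i)) = clrWord s t).card := by
  classical
  unfold clrOrderings clrCount
  congr 1
  refine Finset.filter_congr fun σ _ => ?_
  rw [← isClrPattern_map_kind_iff, List.map_ofFn]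
  rfl

/-- Of the `r!` orderings of a monomial with `r` factors, `clrOrderings` many contribute to the
`clrTerm`; with the weight that compensates for this, the `clrTerm` consists of exactly the terms of
`f` with a single `χ`. -/
theorem clrTerm_apply {s : Chirality} {f : Coeffs N} (hf : IsSuperSymmetric f) (w : Word N) :
    clrTerm s (fun is m ns => ((clrWord s (is, m, ns)).length.factorial : ℂ) /
        clrOrderings s (clrWord s (is, m, ns)) * f (clrWord s (is, m, ns))) w =
      if clrOrderings s w = 0 then 0 else f w := by
  classical
  unfold clrTerm
  set F : Coeffs N := fun w => (w.length.factorial : ℂ) / clrOrderings s w * f w with hF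
  have hext : ∀ w, Function.extend (clrWord s) (fun t => F (clrWord s t)) 0 w =
      if ∃ t, w = clrWord s t then F w else 0 := by
    intro w
    split_ifs with h
    · obtain ⟨t, rfl⟩ := h
      exact Function.FactorsThrough.extend_apply (g := fun t => F (clrWord s t))
        (fun t t' h => by simp only [h]) _ t
    · exact Function.extend_apply' _ _ _ fun ⟨t, ht⟩ => h ⟨t, ht.symm⟩
  change superSymmetrize (Function.extend (clrWord s) (fun t => F (clrWord s t)) 0) w = _
  unfold superSymmetrize
  have hterm : ∀ σ : Equiv.Perm (Fin w.length), koszulSign w σ *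
      Function.extend (clrWord s) (fun t => F (clrWord s t)) 0
        (List.ofFn fun i => w.get (σ i)) =
      if ∃ t, List.ofFn (fun i => w.get (σ i)) = clrWord s t then F w else 0 := by
    intro σ
    rw [hext]
    split_ifs
    · have h1 := congrFun (hf.permute_ofFn σ) w.get
      simp only [permute, List.ofFn_get] at h1
      have h2 : clrOrderings s (List.ofFn fun i => w.get (σ i)) = clrOrderings s w := by
        rw [clrOrderings_ofFn]
        exact clrCount_comp (fun i => (w.get i).kind s) σ
      simp only [hF, h2, List.length_ofFn]
      rw [mul_left_comm]
      congr 1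
    · rw [mul_zero]
  rw [Finset.sum_congr rfl fun σ _ => hterm σ, Finset.sum_ite, Finset.sum_const_zero, add_zero,
    Finset.sum_const, ← clrOrderings_eq_card, nsmul_eq_mul, hF]
  have hfac : (w.length.factorial : ℂ) ≠ 0 := by exact_mod_cast w.length.factorial_ne_zero
  split_ifs with h
  · simp [h]
  · have h' : (clrOrderings s w : ℂ) ≠ 0 := by exact_mod_cast h
    field_simp

theorem countP_isHigh_clrWord (s : Chirality) (t : List (Fin N) × ℤ × List ℤ) :
    (clrWord s t).countP (Letter.isHigh s) = 1 := by
  have h1 : ∀ l : List (Fin N), (l.map (rho s)).countP (Letter.isHigh s) = 0 := fun l => by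
    rw [List.countP_eq_zero]; simp [isHigh]
  have h2 : ∀ l : List ℤ, (l.map (phi (N := N) s)).countP (Letter.isHigh s) = 0 := fun l => by
    rw [List.countP_eq_zero]; simp [isHigh]
  rw [clrWord, List.countP_append, List.countP_cons, h1, h2]
  simp [isHigh]

theorem countP_isOdd_clrWord (s : Chirality) (t : List (Fin N) × ℤ × List ℤ) :
    (clrWord s t).countP Letter.isOdd = 1 := by
  have h1 : ∀ l : List (Fin N), (l.map (rho s)).countP Letter.isOdd = 0 := fun l => by
    rw [List.countP_eq_zero]; simp [isOdd]
  have h2 : ∀ l : List ℤ, (l.map (phi (N := N) s)).countP Letter.isOdd = 0 := fun l => by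
    rw [List.countP_eq_zero]; simp [isOdd]
  rw [clrWord, List.countP_append, List.countP_cons, h1, h2]
  simp [isOdd]

theorem perm_of_clrOrderings_ne_zero {s : Chirality} {w : Word N} (h : clrOrderings s w ≠ 0) :
    ∃ t, w.Perm (clrWord s t) := by
  classical
  rw [clrOrderings_eq_card, Finset.card_ne_zero] at h
  obtain ⟨σ, hσ⟩ := h
  obtain ⟨t, ht⟩ := (Finset.mem_filter.mp hσ).2
  refine ⟨t, ?_⟩
  rw [← ht]
  have := (Equiv.Perm.ofFn_comp_perm σ w.get).symm
  rwa [List.ofFn_get] at this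

theorem clrOrderings_ne_zero_of_perm {s : Chirality} {w : Word N} {t}
    (h : w.Perm (clrWord s t)) : clrOrderings s w ≠ 0 := by
  classical
  obtain ⟨v', hv'⟩ : ∃ v' : Fin w.length → Letter N, List.ofFn v' = clrWord s t := by
    rw [h.length_eq]
    exact ⟨_, List.ofFn_get _⟩
  obtain ⟨σ, hσ⟩ := exists_perm_of_ofFn_perm (v := w.get) (v' := v')
    (by rwa [List.ofFn_get, hv'])
  rw [clrOrderings_eq_card, Finset.card_ne_zero]
  refine ⟨σ, Finset.mem_filter.mpr ⟨Finset.mem_univ _, t, ?_⟩⟩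
  rw [← hv', ← hσ]
  rfl

/-- A monomial of fermion number `1` with at most one high factor is, up to the order of its
factors, of the form `ρ ⋯ ρ χ φ ⋯ φ`: there must be a `χ`, which uses up the bound on the high
factors, so that there is no `F` and nothing to compensate a `χ̄` or `ζ`. -/
theorem exists_perm_clrWord {s : Chirality} {w : Word N} (hs : ∀ x ∈ w, x.chirality = s)
    (hF : (w.map Letter.fermionNumber).sum = 1) (hc : w.countP (Letter.isHigh s) ≤ 1) :
    ∃ t, w.Perm (clrWord s t) := by
  have h1 : ∀ w : Word N, (∀ x ∈ w, x.chirality = s) →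
      (w.map Letter.fermionNumber).sum + w.countP (fun x => x.kind s = 3) ≤
        w.countP (Letter.isHigh s) := by
    intro w
    induction w with
    | nil => simp
    | cons x w ih =>
      intro hw
      have h2 := ih fun y hy => hw y (List.mem_cons_of_mem _ hy)
      have h3 := hw x List.mem_cons_self
      have h4 : x.fermionNumber + (if x.kind s = 3 then 1 else 0 : ℕ) ≤
          (if x.isHigh s then 1 else 0 : ℕ) := by
        clear h2 ih hw
        subst h3
        cases x <;> simp [kind, isHigh, fermionNumber, Letter.chirality]
      rw [List.map_cons, List.sum_cons, List.countP_cons, List.countP_cons]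
      simp only [decide_eq_true_eq]
      push_cast at h2 h4 ⊢
      linarith
  have h2 := h1 w hs
  have h3 : ∀ x ∈ w, x.kind s ≠ 3 := by
    have : w.countP (fun x => x.kind s = 3) = 0 := by omega
    rw [List.countP_eq_zero] at this
    simpa using this
  have h4 : ∀ w : Word N, (∀ x ∈ w, x.kind s ≠ 3) → ∃ (is : List (Fin N)) (ms ns : List ℤ),
      w.Perm (is.map (rho s) ++ (ms.map (chi s) ++ ns.map (phi s))) ∧
      (w.map Letter.fermionNumber).sum = ms.length := by
    intro w
    induction w with
    | nil => exact fun _ => ⟨[], [], [], by simp, by simp⟩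
    | cons x w ih =>
      intro hw
      obtain ⟨is, ms, ns, hp, hl⟩ := ih fun y hy => hw y (List.mem_cons_of_mem _ hy)
      have hx := hw x List.mem_cons_self
      cases x with
      | rho a i =>
        obtain rfl : a = s := by by_contra h; simp [kind, h] at hx
        exact ⟨i :: is, ms, ns, hp.cons _, by simpa [fermionNumber] using hl⟩
      | chi a m =>
        obtain rfl : a = s := by by_contra h; simp [kind, h] at hx
        refine ⟨is, m :: ms, ns, (hp.cons _).trans ?_, by
          simp [fermionNumber, hl, add_comm]⟩
        exact List.perm_middle.symm
      | phi a m =>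
        obtain rfl : a = s := by by_contra h; simp [kind, h] at hx
        refine ⟨is, ms, m :: ns, (hp.cons _).trans ?_, by simpa [fermionNumber] using hl⟩
        rw [← List.append_assoc, ← List.append_assoc]
        exact List.perm_middle.symm
      | _ => simp [kind] at hx
  obtain ⟨is, ms, ns, hp, hl⟩ := h4 w h3
  rw [hF] at hl
  obtain ⟨m, rfl⟩ := List.length_eq_one_iff.mp (by exact_mod_cast hl.symm)
  exact ⟨(is, m, ns), by simpa [clrWord] using hp⟩

/-! ### The cyclic Leibniz rule -/

theorem derivation_cons_of_inert {q : Letter N → Letter N → ℂ} {x : Letter N}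
    (hq : ∀ y, q y x = 0) (hx : x.isOdd = false) (f : Coeffs N) (w : Word N) :
    derivation true q f (x :: w) = derivation true q (fun w => f (x :: w)) w := by
  unfold derivation
  refine (Fin.sum_univ_succ (n := w.length) _).trans ?_
  simp [hq, hx]

theorem derivation_append_of_inert {q : Letter N → Letter N → ℂ} {u : Word N}
    (hq : ∀ x ∈ u, ∀ y, q y x = 0) (hu : ∀ x ∈ u, x.isOdd = false) (f : Coeffs N) (w : Word N) :
    derivation true q f (u ++ w) = derivation true q (fun w => f (u ++ w)) w := by
  induction u generalizing f with
  | nil => rfl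
  | cons x u ih =>
    rw [List.cons_append, derivation_cons_of_inert (hq x List.mem_cons_self)
      (hu x List.mem_cons_self), ih (fun y hy => hq y (List.mem_cons_of_mem _ hy))
      fun y hy => hu y (List.mem_cons_of_mem _ hy)]
    rfl

theorem perm_update_cyclic {α : Type*} {k : ℕ} (v : Fin (k + 1) → α) (p : Fin (k + 1)) (y : α) :
    (List.ofFn (Function.update v p y)).Perm (y :: List.ofFn fun j : Fin k => v (p + j.succ)) := by
  refine (Equiv.Perm.ofFn_comp_perm (Equiv.addLeft p) (Function.update v p y)).symm.trans ?_
  rw [List.ofFn_succ]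
  simp

/-- Closedness, evaluated on the monomials `ρ ⋯ ρ φ ⋯ φ`, is the cyclic Leibniz rule. -/
theorem cyclicLeibniz_of_closed {D : ℤ → ℂ} {s : Chirality} {f : Coeffs N}
    (hf : IsSuperSymmetric f) (hclosed : ∀ w, derivation true (koszulKernel D s) f w = 0)
    (is : List (Fin N)) (k : ℕ) (n : Fin (k + 1) → ℤ) :
    ∑ p : Fin (k + 1), ∑' m : ℤ,
      D (m - n p) * f (clrWord s (is, m, List.ofFn fun j : Fin k => n (p + j.succ))) = 0 := by
  have h := hclosed (is.map (rho s) ++ List.ofFn fun i => phi s (n i))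
  rw [derivation_append_of_inert (by simp [koszulKernel, isLow]) (by simp [isOdd]),
    derivation_ofFn] at h
  simp only [diffOn, Finset.sum_apply, opAt] at h
  have hsign : ∀ p : Fin (k + 1), leftSign (fun i => phi (N := N) s (n i)) p = 1 := fun p =>
    Finset.prod_eq_one fun j _ => rfl
  have hterm : ∀ p : Fin (k + 1), ∑' y : Letter N, koszulKernel D s y (phi s (n p)) *
      f (is.map (rho s) ++ List.ofFn (Function.update (fun i => phi s (n i)) p y)) =
      coef (phi (N := N) s 0) * ∑' m : ℤ,
        D (m - n p) * f (clrWord s (is, m, List.ofFn fun j : Fin k => n (p + j.succ))) := by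
    intro p
    have hl : (phi (N := N) s (n p)).isLow s := by simp [isLow]
    rw [tsum_letter_eq (pos_raise hl) fun y hy => by rw [koszulKernel_of_ne hy, zero_mul],
      ← tsum_mul_left]
    refine tsum_congr fun m => ?_
    have hcoef : coef (phi (N := N) s (n p)) = coef (phi (N := N) s 0) := by cases s <;> rfl
    have hp := perm_update_cyclic (fun i => phi (N := N) s (n i)) p (chi s m)
    have hperm : (is.map (rho s) ++
        List.ofFn (Function.update (fun i => phi s (n i)) p (chi s m))).Perm
        (clrWord s (is, m, List.ofFn fun j : Fin k => n (p + j.succ))) := by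
      rw [clrWord, List.map_ofFn]
      exact hp.append_left _
    rw [koszulKernel_raise hl, hcoef, mul_assoc]
    congr 2
    exact hf.eq_of_perm hperm 
      ((hperm.countP_eq _).trans (countP_isOdd_clrWord _ _)).le
  simp only [hsign, one_mul, hterm] at h
  rw [← Finset.mul_sum] at h
  exact (mul_eq_zero.mp h).resolve_left (coef_ne_zero _)

/-- The coefficients of the terms with a single `χ`, corrected by the number of times each monomial
occurs in the sum over all sites, satisfy the cyclic Leibniz rule. -/
theorem satisfiesCLR_of_closed {D : ℤ → ℂ} {s : Chirality} {f : Coeffs N}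
    (hf : IsLocalFunctional f) (hclosed : ∀ w, derivation true (koszulKernel D s) f w = 0) :
    SatisfiesCLR D fun (is : List (Fin N)) m ns =>
      ((clrWord s (is, m, ns)).length.factorial : ℂ) /
        clrOrderings s (clrWord s (is, m, ns)) * f (clrWord s (is, m, ns)) := by
  -- The combinatorial factor depends only on the numbers of factors of each kind.
  have hord : ∀ (is is' : List (Fin N)) (m m' : ℤ) (ns ns' : List ℤ), is.length = is'.length →
      ns.length = ns'.length → ((clrWord s (is, m, ns)).length.factorial : ℂ) /
        clrOrderings s (clrWord s (is, m, ns)) =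
      ((clrWord s (is', m', ns')).length.factorial : ℂ) /
        clrOrderings s (clrWord s (is', m', ns')) := by
    intro is is' m m' ns ns' h1 h2
    have h3 : clrOrderings s (clrWord s (is, m, ns)) = clrOrderings s (clrWord s (is', m', ns')) :=
      clrOrderings_congr (by
        simp [clrWord, kind, Function.comp_def, List.map_const', h1, h2])
    rw [h3]
    simp [clrWord, h1, h2]
  refine ⟨fun is js m ns h => ?_, fun is m ns ls h => ?_, fun is m ns a => ?_, fun r k => ?_,
    fun is k n => ?_⟩
  · rw [hord is js m m ns ns h.length_eq rfl]
    congr 1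
    exact hf.superSymmetric.eq_of_perm ((h.map _).append_right _) (countP_isOdd_clrWord _ _).le
  · rw [hord is is m m ns ls rfl h.length_eq]
    congr 1
    exact hf.superSymmetric.eq_of_perm (((h.map _).cons _).append_left _)
      (countP_isOdd_clrWord _ _).le
  · rw [hord is is (m + a) m (ns.map (· + a)) ns rfl (by simp)]
    congr 1
    rw [← hf.translationInvariant a (clrWord s (is, m, ns))]
    simp [clrWord, Letter.shift, Function.comp_def]
  · obtain ⟨L, M, hL, hM, h⟩ := hf.isLocal (r + (k + 1))
    by_cases hex : ∃ (is : List (Fin N)) (ns : List ℤ), is.length = r ∧ ns.length = k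
    · obtain ⟨is₀, ns₀, hr, hk⟩ := hex
      set A := ‖((clrWord s (is₀, 0, ns₀)).length.factorial : ℂ) /
        clrOrderings s (clrWord s (is₀, 0, ns₀))‖ with hA
      refine ⟨(A + 1) * L, M, by positivity, hM, fun is m ns h1 h2 n hn => ?_⟩
      rw [hord is is₀ m 0 ns ns₀ (h1.trans hr.symm) (h2.trans hk.symm), norm_mul, ← hA, mul_assoc]
      have h3 : ‖f (clrWord s (is, m, ns))‖ ≤ L * Real.exp (-M * |((m - n : ℤ) : ℝ)|) := by
        refine h _ (by simp [clrWord, h1, h2]) m ?_ n ?_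
        · simp [sites, clrWord, Letter.site]
        · simp only [sites, clrWord, List.filterMap_append, List.mem_append, List.mem_filterMap]
          exact Or.inr ⟨phi s n, by simp [hn], rfl⟩
      refine mul_le_mul (by linarith) h3 (norm_nonneg _) (by positivity)
    · exact ⟨1, 1, one_pos, one_pos, fun is m ns h1 h2 => absurd ⟨is, ns, h1, h2⟩ hex⟩
  · rw [← mul_zero (((clrWord s (is, (0 : ℤ), List.ofFn fun j : Fin k =>
        n j.succ)).length.factorial : ℂ) /
      clrOrderings s (clrWord s (is, (0 : ℤ), List.ofFn fun j : Fin k => n j.succ))),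
      ← cyclicLeibniz_of_closed hf.superSymmetric hclosed is k n, Finset.mul_sum]
    refine Finset.sum_congr rfl fun p _ => ?_
    rw [← tsum_mul_left]
    refine tsum_congr fun m => ?_
    rw [hord is is m 0 (List.ofFn fun j : Fin k => n (p + j.succ)) (List.ofFn fun j : Fin k =>
      n j.succ) rfl (by simp)]
    ring

/-! ### Decomposition of closed functionals -/

theorem permute_weight {σ : Equiv.Perm (Fin d)} {c f : (Fin d → Letter N) → ℂ}
    (hc : ∀ v, c (v ∘ σ) = c v) (hf : permute σ f = f) :
    permute σ (fun v => c v * f v) = fun v => c v * f v := by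
  funext v
  have := congrFun hf v
  simp only [permute] at this ⊢
  rw [hc, mul_left_comm, this]

theorem highCount_comp_perm (s : Chirality) (v : Fin d → Letter N) (σ : Equiv.Perm (Fin d)) :
    highCount s Finset.univ (v ∘ σ) = highCount s Finset.univ v := by
  rw [highCount_eq_countP, highCount_eq_countP]
  exact (Equiv.Perm.ofFn_comp_perm σ v).countP_eq _

theorem fermionNumber_raise {s : Chirality} {x : Letter N} (h : x.isLow s) (m : ℤ) :
    (x.raise m).fermionNumber = x.fermionNumber + 1 := by
  cases x <;> simp_all [isLow, raise, fermionNumber]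

theorem chirality_raise (x : Letter N) (m : ℤ) : (x.raise m).chirality = x.chirality := by
  cases x <;> rfl

theorem sum_fermionNumber_update {s : Chirality} {D : ℤ → ℂ} {v : Fin d → Letter N} {i : Fin d}
    {y : Letter N} (hy : koszulKernel D s y (v i) ≠ 0) :
    ∑ j, (Function.update v i y j).fermionNumber = ∑ j, (v j).fermionNumber + 1 := by
  obtain ⟨h1, h2⟩ := koszulKernel_ne_zero hy
  have h3 : y.fermionNumber = (v i).fermionNumber + 1 := by rw [h2, fermionNumber_raise h1]
  rw [← Finset.add_sum_erase _ _ (Finset.mem_univ i),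
    ← Finset.add_sum_erase _ (fun j => (v j).fermionNumber) (Finset.mem_univ i),
    Function.update_self, h3, add_right_comm]
  congr 2
  refine Finset.sum_congr rfl fun j hj => ?_
  rw [Function.update_of_ne (Finset.ne_of_mem_erase hj)]

theorem forall_chirality_update {s s' : Chirality} {D : ℤ → ℂ} {v : Fin d → Letter N} {i : Fin d}
    {y : Letter N} (hy : koszulKernel D s y (v i) ≠ 0) :
    (∀ j, (Function.update v i y j).chirality = s') ↔ ∀ j, (v j).chirality = s' := by
  refine forall_congr' fun j => ?_
  by_cases hj : j = i
  · subst hj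
    rw [Function.update_self, (koszulKernel_ne_zero hy).2, chirality_raise]
  · rw [Function.update_of_ne hj]

/-- The monomials with at least two factors `χ_s`, `F_s` of a closed local functional have a
primitive, which inherits the grading of the functional. -/
theorem exists_graded_primitive {D : ℤ → ℂ} (hD : IsDifferenceOperator D) (s : Chirality)
    {f : (Fin d → Letter N) → ℂ} {q : ℤ} (hperm : ∀ σ, permute σ f = f)
    (hshift : ∀ a v, f (fun i => (v i).shift a) = f v) (hloc : IsPairLocal f)
    (hclosed : diffOn (koszulKernel D s) Finset.univ f = 0)
    (hchir : ∀ v, f v ≠ 0 → ∀ i, (v i).chirality = s)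
    (hF : ∀ v, f v ≠ 0 → ∑ i, (v i).fermionNumber = q) :
    ∃ g : (Fin d → Letter N) → ℂ, (∀ σ, permute σ g = g) ∧
      (∀ a v, g (fun i => (v i).shift a) = g v) ∧ IsPairLocal g ∧
      (∀ v, g v ≠ 0 → (∀ i, (v i).chirality = s) ∧ ∑ i, (v i).fermionNumber = q + 1) ∧
      (f = 0 → g = 0) ∧
      diffOn (koszulKernel D s) Finset.univ g =
        fun v => (if 2 ≤ highCount s Finset.univ v then 1 else 0) * f v := by
  classical
  by_cases hf0 : f = 0
  · refine ⟨0, fun σ => ?_, fun _ _ => rfl, IsPairLocal.zero, fun v hv => absurd rfl hv,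
      fun _ => rfl, ?_⟩
    · funext v; simp [permute]
    · funext v; simp [diffOn, opAt, hf0]
  have hnorm : ∀ (p : Prop) [Decidable p], ‖(if p then 1 else 0 : ℂ)‖ ≤ 1 := fun p _ => by
    split_ifs <;> simp
  obtain ⟨g, hg1, hg2, hg3, hg4⟩ := exists_symmetric_primitive hD s
    (f := fun v => (if 2 ≤ highCount s Finset.univ v then 1 else 0) * f v)
    (fun σ => permute_weight (fun v => by rw [highCount_comp_perm]) (hperm σ))
    (fun a v => by rw [hshift, highCount_shift]) (hloc.weight fun v => hnorm _)
    (by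
      rw [diffOn_weight (c := fun v => if 2 ≤ highCount s Finset.univ v then (1 : ℂ) else 0)
        (c' := fun v => if 2 ≤ highCount s Finset.univ v + 1 then (1 : ℂ) else 0), hclosed]
      · funext v; simp
      · intro v i hi y hy
        rw [highCount_update hi (isHigh_of_koszulKernel_ne_zero hy)
          (not_isHigh_of_isLow (koszulKernel_ne_zero hy).1)])
    (fun v hv => by
      by_contra h
      exact hv (by simp [h]))
  -- `c r` is the projection onto type `s` and fermion number `r`.  As the kernel acts on
  -- coefficients, a monomial of the differential has one unit less than that of the primitive.
  set c : ℤ → (Fin d → Letter N) → ℂ := fun r v =>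
    if (∀ i, (v i).chirality = s) ∧ ∑ i, (v i).fermionNumber = r then 1 else 0 with hc
  refine ⟨fun v => c (q + 1) v * g v, fun σ => permute_weight (fun v => ?_) (hg1 σ),
    fun a v => ?_, hg3.weight fun v => hnorm _, fun v hv => ?_, fun h => absurd h hf0, ?_⟩
  · have h1 : ∑ i, ((v ∘ σ) i).fermionNumber = ∑ i, (v i).fermionNumber :=
      Equiv.sum_comp σ fun i => (v i).fermionNumber
    have h2 : (∀ i, ((v ∘ σ) i).chirality = s) ↔ ∀ i, (v i).chirality = s :=
      σ.forall_congr_left (p := fun i => ((v ∘ σ) i).chirality = s) |>.trans (by simp)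
    simp only [hc, h1, h2]
  · have h1 : ∀ x : Letter N, (x.shift a).chirality = x.chirality := fun x => by cases x <;> rfl
    have h2 : ∀ x : Letter N, (x.shift a).fermionNumber = x.fermionNumber := fun x => by
      cases x <;> rfl
    beta_reduce
    simp only [hc, h1, h2, hg2]
  · by_contra h
    exact hv (by simp only [hc, if_neg h, zero_mul])
  · rw [diffOn_weight (c := c (q + 1)) (c' := c q), hg4]
    · funext v
      by_cases hv : f v = 0
      · simp [hv]
      · have h1 : c q v = 1 := if_pos ⟨hchir v hv, hF v hv⟩
        rw [h1, one_mul]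
    · intro v i _ y hy
      simp only [hc, sum_fermionNumber_update hy, forall_chirality_update hy, add_left_inj]

theorem chirality_of_isOfType {s : Chirality} {f : Coeffs N} (hf : IsOfType s f) {w : Word N}
    (hw : f w ≠ 0) : ∀ x ∈ w, x.chirality = s := by
  have h1 := congrFun hf.1 w
  rw [numberOp_apply, Pi.zero_apply, mul_eq_zero, or_iff_left hw, Nat.cast_eq_zero,
    List.countP_eq_zero] at h1
  intro x hx
  have h2 := h1 x hx
  revert h2
  cases x.chirality <;> cases s <;> simp [Chirality.flip]

theorem isOfType_of_chirality {s : Chirality} {f : Coeffs N}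
    (hf : ∀ w, f w ≠ 0 → w ≠ [] ∧ ∀ x ∈ w, x.chirality = s) : IsOfType s f := by
  refine ⟨?_, fun w hw => ?_⟩
  · funext w
    rw [numberOp_apply]
    by_cases hw : f w = 0
    · rw [hw, mul_zero]; rfl
    · have : (w.countP fun x => x.chirality = s.flip) = 0 := by
        rw [List.countP_eq_zero]
        intro x hx
        rw [(hf w hw).2 x hx]
        cases s <;> simp [Chirality.flip]
      rw [this, Nat.cast_zero, zero_mul]; rfl
  · rw [numberOp_apply]
    refine mul_ne_zero ?_ hw
    rw [Nat.cast_ne_zero, Ne, List.countP_eq_zero]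
    intro h
    obtain ⟨x, hx⟩ := List.exists_mem_of_ne_nil w (hf w hw).1
    exact h x hx (by simpa using (hf w hw).2 x hx)

theorem IsLocalFunctional.isPairLocal {f : Coeffs N} (hf : IsLocalFunctional f) (d : ℕ) :
    IsPairLocal fun v : Fin d → Letter N => f (List.ofFn v) := by
  obtain ⟨L, M, hL, hM, h⟩ := hf.isLocal d
  refine ⟨L, M, hL, hM, fun v i j m n hm hn => h _ (List.length_ofFn) m ?_ n ?_⟩
  · exact List.mem_filterMap.mpr ⟨v i, List.mem_ofFn.mpr ⟨i, rfl⟩, hm⟩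
  · exact List.mem_filterMap.mpr ⟨v j, List.mem_ofFn.mpr ⟨j, rfl⟩, hn⟩

theorem isLocalFunctional_of_ofFn {f : Coeffs N} {g : ∀ d, (Fin d → Letter N) → ℂ}
    (hf : ∀ d (v : Fin d → Letter N), f (List.ofFn v) = g d v)
    (hperm : ∀ d σ, permute σ (g d) = g d)
    (hshift : ∀ d a v, g d (fun i => (v i).shift a) = g d v) (hloc : ∀ d, IsPairLocal (g d)) :
    IsLocalFunctional f where
  superSymmetric := isSuperSymmetric_of_permute fun d σ => by
    simpa only [hf] using hperm d σ
  translationInvariant a w := by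
    rw [← List.ofFn_get w, List.map_ofFn, hf, hf]
    exact hshift _ a _
  isLocal d := by
    obtain ⟨L, M, hL, hM, h⟩ := hloc d
    refine ⟨L, M, hL, hM, ?_⟩
    rintro w rfl m hm n hn
    obtain ⟨x, hx, hxm⟩ := List.mem_filterMap.mp hm
    obtain ⟨y, hy, hyn⟩ := List.mem_filterMap.mp hn
    obtain ⟨i, rfl⟩ := List.mem_iff_get.mp hx
    obtain ⟨j, rfl⟩ := List.mem_iff_get.mp hy
    have h1 := h w.get i j m n hxm hyn
    rwa [← hf, List.ofFn_get] at h1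

end LatticeSUSY

theorem theorem2 (N : ℕ) (D : ℤ → ℂ) (hD : IsDifferenceOperator D) (s : Chirality)
    (P : Coeffs N) (hP : IsLocalFunctional P) (hPtype : IsOfType s P)
    (hPF : HasFermionNumber 1 P) (hclosed : supercharge D s.flip P = 0) :
    ∃ (C : CLRCoeffs N) (R : Coeffs N),
      SatisfiesCLR D C ∧
      IsLocalFunctional R ∧ IsOfType s R ∧ HasFermionNumber 2 R ∧
      P = clrTerm s C + supercharge D s.flip R ∧
      ∀ d : ℕ, VanishesInDegree d P → VanishesInDegree d (clrTerm s C) ∧ VanishesInDegree d R := by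
  have hchir : ∀ w, P w ≠ 0 → ∀ x ∈ w, x.chirality = s := fun w hw =>
    chirality_of_isOfType hPtype hw
  have hd : ∀ d, diffOn (koszulKernel D s) Finset.univ
      (fun v : Fin d → Letter N => P (List.ofFn v)) = 0 := fun d => by
    funext v
    rw [← supercharge_ofFn D hchir, hclosed]; rfl
  have hfn : ∀ w : Word N, (w.map Letter.fermionNumber).sum =
      ∑ i, (w.get i).fermionNumber := fun w => by
    rw [← List.sum_ofFn]
    conv_lhs => rw [← List.ofFn_get w, List.map_ofFn]
    rfl
  choose g hgperm hgshift hgloc hgsupp hgzero hgd using fun d => exists_graded_primitive hD s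
    (f := fun v : Fin d → Letter N => P (List.ofFn v)) (q := 1) hP.superSymmetric.permute_ofFn
    (fun a v => by
      rw [← hP.translationInvariant a (List.ofFn v), List.map_ofFn]; rfl)
    (hP.isPairLocal d) (hd d)
    (fun v hv i => hchir _ hv _ (List.mem_ofFn.mpr ⟨i, rfl⟩))
    (fun v hv => by
      rw [← hPF _ hv, List.map_ofFn, List.sum_ofFn]; rfl)
  set R : Coeffs N := fun w => g w.length w.get with hR
  have hRg : ∀ d (v : Fin d → Letter N), R (List.ofFn v) = g d v := fun d v => apply_ofFn g v
  have hRF : HasFermionNumber 2 R := fun w hw => by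
    rw [hfn, (hgsupp _ _ hw).2]; norm_num
  have hRchir : ∀ w, R w ≠ 0 → ∀ x ∈ w, x.chirality = s := by
    intro w hw x hx
    obtain ⟨i, rfl⟩ := List.mem_iff_get.mp hx
    exact (hgsupp _ _ hw).1 i
  refine ⟨_, R, satisfiesCLR_of_closed (s := s) hP fun w => ?_,
    isLocalFunctional_of_ofFn hRg hgperm hgshift hgloc,
    isOfType_of_chirality fun w hw => ⟨?_, hRchir w hw⟩, hRF, ?_, fun d hPd => ⟨fun w hw => ?_, ?_⟩⟩
  · rw [derivation_get, hd]; rfl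
  · rintro rfl
    exact absurd (hRF _ hw) (by simp)
  · funext w
    rw [Pi.add_apply, clrTerm_apply hP.superSymmetric]
    have h1 : supercharge D s.flip R w =
        (if 2 ≤ w.countP (Letter.isHigh s) then 1 else 0) * P w := by
      conv_lhs => rw [← List.ofFn_get w, supercharge_ofFn D hRchir]
      simp only [hRg, hgd, highCount_eq_countP, List.ofFn_get]
    rw [h1]
    by_cases hw : P w = 0
    · simp [hw]
    -- A monomial is in the `clrTerm` or in the image of the differential according to its number
    -- of high factors.
    by_cases hc : 2 ≤ w.countP (Letter.isHigh s)
    · rw [if_pos hc, if_pos, one_mul, zero_add]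
      by_contra h
      obtain ⟨t, ht⟩ := perm_of_clrOrderings_ne_zero h
      rw [ht.countP_eq, countP_isHigh_clrWord] at hc
      omega
    · obtain ⟨t, ht⟩ := exists_perm_clrWord (hchir w hw) (hPF w hw) (by omega)
      rw [if_neg hc, if_neg (clrOrderings_ne_zero_of_perm ht), zero_mul, add_zero]
  · rw [clrTerm_apply hP.superSymmetric, hPd w hw, ite_self]
  · rintro w rfl
    have h1 : g w.length = 0 := hgzero _ (funext fun v => hPd _ List.length_ofFn)
    rw [hR]
    exact congrFun h1 _
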